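/- Let $N\ge 3$ and let $q>0$ be a real number, $q\ne1$. For $1\le i\le N$ put $i'=N+1-i$ and $\varrho_i=\frac N2-i$ if $i<\frac{N+1}2$, $\varrho_i=0$ if $i=\frac{N+1}2$, $\varrho_i=\frac N2-i+1$ if $i>\frac{N+1}2$. Let $(P)$ denote $1$ if $P$ holds and $0$ otherwise, let $C^{ij}=C_{ij}=q^{-\varrho_i}(i=j')$, $K^{kl}_{ij}=C^{ij}C_{kl}$, $$\hat R^{kl}_{ij}=q^{(k=l)-(k=l')}(i=l)(j=k)+(q-q^{-1})(i<l)\bigl((i=k)(j=l)-K^{kl}_{ij}\bigr),$$ $I^{kl}_{ij}=(i=k)(j=l)$ and $\hat R^-=\hat R-(q-q^{-1})I+(q-q^{-1})K$. Sums over repeated upper and lower indices from $1$ to $N$ are understood. Let $X$ be the complex algebra (the coordinate algebra of the quantum Euclidean sphere $\mathrm S_q^{N-1}$) with generators $x_1,\dots,x_N$ and relations $$(\hat R^-)^{kl}_{ij}x_kx_l=q^{-1}x_ix_j+\frac{q^{N-1}-q^{N-3}}{1+q^{N-2}}K^{kl}_{ij}x_kx_l,\qquad C^{kl}x_kx_l=1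 .$$ Let $(\Gamma,\mathrm d)$ be the first order differential calculus over $X$ given by the bimodule relations $$\mathrm dx_i\cdot x_j=(\hat R^-)^{kl}_{ij}x_k\mathrm dx_l+(q-1)x_i\mathrm dx_j+\frac{q^N-q^{N-2}}{1-q^{N-1}}K^{kl}_{ij}x_k\mathrm dx_l+\frac{(1-q)(1+q^{N-2})}{1-q^{N-1}}C^{kl}x_ix_jx_k\mathrm dx_l ,$$ and put $\eta=C^{kl}x_k\mathrm dx_l$. Let $a$ be one of the two numbers $$\alpha^+=-\frac{1+q^{N-2}}{1-q^{N-1}},\qquad \alpha^-=q\,\frac{1+q^{N-2}}{1-q^{N-1}},$$ and let $\gamma_i=\mathrm dx_i+a\,x_i\eta$ for $i=1,\dots,N$. Let $\sigma:\Gamma\otimes_X\Gamma\to\Gamma\otimes_X\Gamma$ be the bimodule homomorphism with $\sigma(\gamma_i\otimes_X\gamma_j)=q(\hat R^-)^{kl}_{ij}\gamma_k\otimes_X\gamma_l$. Let $\Gamma^\wedge_\sigma$ be the quotient of the tensor algebra of the $X$-bimodule $\Gamma$ by the two-sided ideal generated by $\ker(\mathrm{id}-\sigma)$, and let $\Gamma^\wedge_{\sigma0}$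 be the quotient of $\Gamma^\wedge_\sigma$ by the additional relation $\mathrm d\eta=0$, where $\mathrm d\eta=C^{kl}\mathrm dx_k\wedge\mathrm dx_l$. Then $\Gamma^\wedge_{\sigma0}$ is generated as a left $X$-module by the set of all products $\gamma_{i_1}\wedge\dots\wedge\gamma_{i_s}$ with $0\le s\le N$ and $1\le i_1<\dots<i_s\le N$. In particular, for $n>N$ all forms of order $n$ in $\Gamma^\wedge_{\sigma0}$ vanish. -/

import Mathlib

open scoped TensorProduct

noncomputable section

namespace QuantumSphere

/-! ### Structure constants of the quantum group `O_q(N)`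

Indices run over `Fin N`; the element `i : Fin N` stands for the index `i + 1` of `{1, …, N}`, and
`i.rev` stands for `i' = N + 1 - i`. -/

/-- The constants `ϱ_i`. -/
def rho (N : ℕ) (i : Fin N) : ℝ :=
  if 2 * ((i : ℕ) + 1) < N + 1 then (N : ℝ) / 2 - ((i : ℕ) + 1 : ℝ)
  else if 2 * ((i : ℕ) + 1) = N + 1 then 0
  else (N : ℝ) / 2 - ((i : ℕ) + 1 : ℝ) + 1

/-- The metric `C^{ij} = C_{ij} = q^{-ϱ_i} (i = j')`. -/
def metric (N : ℕ) (q : ℝ) (i j : Fin N) : ℝ :=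
  if i = j.rev then q ^ (-rho N i) else 0

/-- `K^{kl}_{ij} = C^{ij} C_{kl}`, written `kMat N q k l i j`. -/
def kMat (N : ℕ) (q : ℝ) (k l i j : Fin N) : ℝ := metric N q i j * metric N q k l

/-- The R-matrix `R̂^{kl}_{ij}` of `O_q(N)`, written `rMat N q k l i j`. -/
def rMat (N : ℕ) (q : ℝ) (k l i j : Fin N) : ℝ :=
  q ^ ((if k = l then (1 : ℤ) else 0) - (if k = l.rev then (1 : ℤ) else 0))
      * (if i = l ∧ j = k then 1 else 0)
    + (q - q⁻¹) * (if i < l then (if i = k ∧ j = l then 1 else 0) - kMat N q k l i j else 0)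

/-- The matrix `R̂⁻ = R̂ - (q - q⁻¹) I + (q - q⁻¹) K`, the inverse of `R̂`. -/
def rMatInv (N : ℕ) (q : ℝ) (k l i j : Fin N) : ℝ :=
  rMat N q k l i j - (q - q⁻¹) * (if k = i ∧ l = j then 1 else 0) + (q - q⁻¹) * kMat N q k l i j

/-! ### The coordinate algebra of the quantum Euclidean sphere -/

/-- The defining relations of the quantum Euclidean sphere. -/
inductive SphereRel (N : ℕ) (q : ℝ) : FreeAlgebra ℂ (Fin N) → FreeAlgebra ℂ (Fin N) → Prop
  | comm (i j : Fin N) : SphereRel N q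
      (∑ k, ∑ l, (rMatInv N q k l i j : ℂ) • (FreeAlgebra.ι ℂ k * FreeAlgebra.ι ℂ l))
      (((q⁻¹ : ℝ) : ℂ) • (FreeAlgebra.ι ℂ i * FreeAlgebra.ι ℂ j)
        + (((q ^ ((N : ℤ) - 1) - q ^ ((N : ℤ) - 3)) / (1 + q ^ ((N : ℤ) - 2)) : ℝ) : ℂ) •
          ∑ k, ∑ l, (kMat N q k l i j : ℂ) • (FreeAlgebra.ι ℂ k * FreeAlgebra.ι ℂ l))
  | radius : SphereRel N q
      (∑ k, ∑ l, (metric N q k l : ℂ) • (FreeAlgebra.ι ℂ k * FreeAlgebra.ι ℂ l)) 1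

/-- The coordinate algebra `X` of the quantum Euclidean sphere. -/
def Sphere (N : ℕ) (q : ℝ) : Type := RingQuot (SphereRel N q)

instance (N : ℕ) (q : ℝ) : Ring (Sphere N q) := inferInstanceAs (Ring (RingQuot (SphereRel N q)))

instance (N : ℕ) (q : ℝ) : Algebra ℂ (Sphere N q) :=
  inferInstanceAs (Algebra ℂ (RingQuot (SphereRel N q)))

/-- The generators `x_i` of `X`. -/
def Sphere.x (N : ℕ) (q : ℝ) (i : Fin N) : Sphere N q :=
  RingQuot.mkAlgHom ℂ (SphereRel N q) (FreeAlgebra.ι ℂ i)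

/-! ### Bimodules

An `A`-bimodule (on which the two actions of `ℂ` agree) is a left module over the enveloping algebra
`A ⊗ Aᵐᵒᵖ`. -/

/-- The enveloping algebra `A ⊗ Aᵐᵒᵖ`. -/
def Env (A : Type) [Ring A] [Algebra ℂ A] : Type := A ⊗[ℂ] Aᵐᵒᵖ

instance (A : Type) [Ring A] [Algebra ℂ A] : Ring (Env A) := inferInstanceAs (Ring (A ⊗[ℂ] Aᵐᵒᵖ))

/-- The element `a ⊗ b` of the enveloping algebra, which acts on a bimodule by `m ↦ a m b`. -/
def Env.tmul {A : Type} [Ring A] [Algebra ℂ A] (a b : A) : Env A := a ⊗ₜ[ℂ] MulOpposite.op b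

/-- The left action `a m` on a bimodule. -/
def lact {A M : Type} [Ring A] [Algebra ℂ A] [AddCommGroup M] [Module (Env A) M]
    (a : A) (m : M) : M := Env.tmul a 1 • m

/-- The right action `m a` on a bimodule. -/
def ract {A M : Type} [Ring A] [Algebra ℂ A] [AddCommGroup M] [Module (Env A) M]
    (m : M) (a : A) : M := Env.tmul 1 a • m

/-- The relations of the tensor algebra `T_A(M)` of an `A`-bimodule `M`; the symbol `Sum.inl a`
stands for `a : A` in degree `0`, and `Sum.inr m` for `m : M` in degree `1`. -/
inductive TensorRel (A M : Type) [Ring A] [Algebra ℂ A] [AddCommGroup M] [Module (Env A) M] :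
    FreeAlgebra ℂ (A ⊕ M) → FreeAlgebra ℂ (A ⊕ M) → Prop
  | scalar (c : ℂ) : TensorRel A M (FreeAlgebra.ι ℂ (Sum.inl (algebraMap ℂ A c)))
      (algebraMap ℂ (FreeAlgebra ℂ (A ⊕ M)) c)
  | add (a b : A) : TensorRel A M (FreeAlgebra.ι ℂ (Sum.inl (a + b)))
      (FreeAlgebra.ι ℂ (Sum.inl a) + FreeAlgebra.ι ℂ (Sum.inl b))
  | mul (a b : A) : TensorRel A M (FreeAlgebra.ι ℂ (Sum.inl (a * b)))
      (FreeAlgebra.ι ℂ (Sum.inl a) * FreeAlgebra.ι ℂ (Sum.inl b))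
  | add_form (m n : M) : TensorRel A M (FreeAlgebra.ι ℂ (Sum.inr (m + n)))
      (FreeAlgebra.ι ℂ (Sum.inr m) + FreeAlgebra.ι ℂ (Sum.inr n))
  | left (a : A) (m : M) : TensorRel A M (FreeAlgebra.ι ℂ (Sum.inr (lact a m)))
      (FreeAlgebra.ι ℂ (Sum.inl a) * FreeAlgebra.ι ℂ (Sum.inr m))
  | right (m : M) (a : A) : TensorRel A M (FreeAlgebra.ι ℂ (Sum.inr (ract m a)))
      (FreeAlgebra.ι ℂ (Sum.inr m) * FreeAlgebra.ι ℂ (Sum.inl a))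

/-- The tensor algebra `T_A(M) = A ⊕ M ⊕ (M ⊗_A M) ⊕ ⋯` of an `A`-bimodule `M`: the universal
algebra receiving an algebra homomorphism from `A` and a compatible `A`-bimodule map from `M`. -/
abbrev BimoduleTensorAlgebra (A M : Type) [Ring A] [Algebra ℂ A] [AddCommGroup M]
    [Module (Env A) M] : Type := RingQuot (TensorRel A M)

/-! ### The first order calculus `Γ = Γ_+` -/

/-- The free bimodule on symbols `d x`, `x ∈ X`. -/
abbrev FreeForms (N : ℕ) (q : ℝ) : Type := Sphere N q →₀ Env (Sphere N q)

/-- The symbol `d x` in the free bimodule. -/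
def symb (N : ℕ) (q : ℝ) (x : Sphere N q) : FreeForms N q := Finsupp.single x 1

open Sphere in
/-- The relations of `Γ_+`: linearity and the Leibniz rule for `d`, and the bimodule relations
`dx_i · x_j = R̂⁻^{kl}_{ij} x_k dx_l + (q-1) x_i dx_j + (q^N-q^{N-2})/(1-q^{N-1}) K^{kl}_{ij} x_k dx_l
+ (1-q)(1+q^{N-2})/(1-q^{N-1}) C^{kl} x_i x_j x_k dx_l`. Each constructor lists `r` for a relation
`r = 0`. -/
inductive FormRel (N : ℕ) (q : ℝ) : FreeForms N q → Prop
  | add (x y : Sphere N q) : FormRel N q (symb N q (x + y) - (symb N q x + symb N q y))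
  | smul (c : ℂ) (x : Sphere N q) :
      FormRel N q (symb N q (c • x) - lact (algebraMap ℂ (Sphere N q) c) (symb N q x))
  | leibniz (x y : Sphere N q) :
      FormRel N q (symb N q (x * y) - (ract (symb N q x) y + lact x (symb N q y)))
  | bimod (i j : Fin N) : FormRel N q
      (ract (symb N q (x N q i)) (x N q j) -
        ((∑ k, ∑ l, lact ((rMatInv N q k l i j : ℂ) • x N q k) (symb N q (x N q l)))
        + lact (((q - 1 : ℝ) : ℂ) • x N q i) (symb N q (x N q j))
        + (∑ k, ∑ l,
            lact ((((q ^ (N : ℤ) - q ^ ((N : ℤ) - 2)) / (1 - q ^ ((N : ℤ) - 1))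
              * kMat N q k l i j : ℝ) : ℂ) • x N q k) (symb N q (x N q l)))
        + (∑ k, ∑ l,
            lact ((((1 - q) * (1 + q ^ ((N : ℤ) - 2)) / (1 - q ^ ((N : ℤ) - 1))
              * metric N q k l : ℝ) : ℂ) • (x N q i * x N q j * x N q k))
              (symb N q (x N q l)))))

/-- The bimodule `Γ = Γ_+` of one-forms. -/
def OneForms (N : ℕ) (q : ℝ) : Type :=
  FreeForms N q ⧸ Submodule.span (Env (Sphere N q)) {r | FormRel N q r}

instance (N : ℕ) (q : ℝ) : AddCommGroup (OneForms N q) :=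
  inferInstanceAs (AddCommGroup
    (FreeForms N q ⧸ Submodule.span (Env (Sphere N q)) {r | FormRel N q r}))

instance (N : ℕ) (q : ℝ) : Module (Env (Sphere N q)) (OneForms N q) :=
  inferInstanceAs (Module (Env (Sphere N q))
    (FreeForms N q ⧸ Submodule.span (Env (Sphere N q)) {r | FormRel N q r}))

/-- The differentiation map `d : X → Γ`. -/
def d (N : ℕ) (q : ℝ) (x : Sphere N q) : OneForms N q :=
  Submodule.Quotient.mk (p := Submodule.span (Env (Sphere N q)) {r | FormRel N q r}) (symb N q x)

/-- The Leibniz rule for `d : X → Γ`. -/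
theorem d_mul (N : ℕ) (q : ℝ) (x y : Sphere N q) :
    d N q (x * y) = ract (d N q x) y + lact x (d N q y) :=
  (Submodule.Quotient.eq _).2 (Submodule.subset_span (FormRel.leibniz x y))

/-- The invariant one-form `η = C^{kl} x_k dx_l`. -/
def eta (N : ℕ) (q : ℝ) : OneForms N q :=
  ∑ k, ∑ l, lact ((metric N q k l : ℂ) • Sphere.x N q k) (d N q (Sphere.x N q l))

/-- `α⁺ = -(1+q^{N-2})/(1-q^{N-1})`. -/
def alphaPlus (N : ℕ) (q : ℝ) : ℝ := -(1 + q ^ ((N : ℤ) - 2)) / (1 - q ^ ((N : ℤ) - 1))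

/-- `α⁻ = q(1+q^{N-2})/(1-q^{N-1})`. -/
def alphaMinus (N : ℕ) (q : ℝ) : ℝ := q * (1 + q ^ ((N : ℤ) - 2)) / (1 - q ^ ((N : ℤ) - 1))

/-- `γ_i = dx_i + a x_i η`; this is `γ⁺_i` for `a = α⁺` and `γ⁻_i` for `a = α⁻`. -/
def gam (N : ℕ) (q a : ℝ) (i : Fin N) : OneForms N q :=
  d N q (Sphere.x N q i) + lact ((a : ℂ) • Sphere.x N q i) (eta N q)

/-! ### The braiding and the higher order calculi -/

/-- The tensor algebra `Γ^⊗` of `Γ` over `X`. -/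
abbrev TensorForms (N : ℕ) (q : ℝ) : Type := BimoduleTensorAlgebra (Sphere N q) (OneForms N q)

/-- The inclusion `X → Γ^⊗` in degree zero. -/
def fnT (N : ℕ) (q : ℝ) : Sphere N q →+* TensorForms N q where
  toFun x := RingQuot.mkAlgHom ℂ _ (FreeAlgebra.ι ℂ (Sum.inl x))
  map_one' := by
    have h := RingQuot.mkAlgHom_rel ℂ (TensorRel.scalar (A := Sphere N q) (M := OneForms N q) 1)
    simpa using h
  map_mul' x y := by
    have h := RingQuot.mkAlgHom_rel ℂ (TensorRel.mul (A := Sphere N q) (M := OneForms N q) x y)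
    simpa using h
  map_zero' := by
    have h := RingQuot.mkAlgHom_rel ℂ (TensorRel.scalar (A := Sphere N q) (M := OneForms N q) 0)
    simpa using h
  map_add' x y := by
    have h := RingQuot.mkAlgHom_rel ℂ (TensorRel.add (A := Sphere N q) (M := OneForms N q) x y)
    simpa using h

/-- The inclusion `Γ → Γ^⊗` in degree one. -/
def formT (N : ℕ) (q : ℝ) : OneForms N q →+ TensorForms N q :=
  AddMonoidHom.mk' (fun θ => RingQuot.mkAlgHom ℂ _ (FreeAlgebra.ι ℂ (Sum.inr θ))) fun θ η => by
    have h := RingQuot.mkAlgHom_rel ℂ (TensorRel.add_form (A := Sphere N q) (M := OneForms N q) θ η)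
    simpa using h

theorem formT_lact (N : ℕ) (q : ℝ) (x : Sphere N q) (θ : OneForms N q) :
    formT N q (lact x θ) = fnT N q x * formT N q θ := by
  have h := RingQuot.mkAlgHom_rel ℂ (TensorRel.left (A := Sphere N q) (M := OneForms N q) x θ)
  rw [map_mul] at h
  exact h

theorem fnT_smul (N : ℕ) (q : ℝ) (c : ℂ) (x : Sphere N q) :
    fnT N q (c • x) = c • fnT N q x := by
  have h := RingQuot.mkAlgHom_rel ℂ (TensorRel.scalar (A := Sphere N q) (M := OneForms N q) c)
  rw [AlgHom.commutes] at h
  rw [Algebra.smul_def, map_mul, Algebra.smul_def]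
  exact congrArg (· * fnT N q x) h

instance (N : ℕ) (q : ℝ) : Module (Sphere N q) (TensorForms N q) := Module.compHom _ (fnT N q)

/-- The graph of the braiding `σ : Γ ⊗_X Γ → Γ ⊗_X Γ`, the left `X`-linear map with
`σ(γ_i ⊗ γ_j) = q R̂⁻^{kl}_{ij} γ_k ⊗ γ_l`. The products `γ_i ⊗ γ_j` generate the left module
`Γ ⊗_X Γ`, the component of degree two of `Γ^⊗`, so that the graph of `σ` is the left
`X`-submodule generated by the pairs `(γ_i ⊗ γ_j, q R̂⁻^{kl}_{ij} γ_k ⊗ γ_l)`. -/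
def braidingGraph (N : ℕ) (q a : ℝ) :
    Submodule (Sphere N q) (TensorForms N q × TensorForms N q) :=
  Submodule.span (Sphere N q) (Set.range fun p : Fin N × Fin N =>
    (formT N q (gam N q a p.1) * formT N q (gam N q a p.2),
      ∑ k, ∑ l, ((q * rMatInv N q k l p.1 p.2 : ℝ) : ℂ) •
        (formT N q (gam N q a k) * formT N q (gam N q a l))))

/-- The kernel of `id - σ` in `Γ ⊗_X Γ`, i.e. the elements `ω` with `σ(ω) = ω`. -/
def antisymKernel (N : ℕ) (q a : ℝ) : Set (TensorForms N q) :=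
  {ω | (ω, ω) ∈ braidingGraph N q a}

/-- The higher order calculus `Γ^∧_σ`: the quotient of `Γ^⊗` by the two-sided ideal generated by
the kernel of `id - σ`. -/
abbrev SigmaForms (N : ℕ) (q a : ℝ) : Type :=
  RingQuot fun ω τ : TensorForms N q => ω ∈ antisymKernel N q a ∧ τ = 0

/-- The projection `Γ^⊗ → Γ^∧_σ`. -/
def toSigma (N : ℕ) (q a : ℝ) : TensorForms N q →ₐ[ℂ] SigmaForms N q a := RingQuot.mkAlgHom ℂ _

/-- The two-form `dη = C^{kl} dx_k ∧ dx_l` in `Γ^∧_σ` (see `differential_eta`). -/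
def dEta (N : ℕ) (q a : ℝ) : SigmaForms N q a :=
  ∑ k, ∑ l, (metric N q k l : ℂ) •
    (toSigma N q a (formT N q (d N q (Sphere.x N q k)))
      * toSigma N q a (formT N q (d N q (Sphere.x N q l))))

/-- `dEta` is the value at `η` of every differential `D` on `Γ^∧_σ` that extends `d : X → Γ`, satisfies
the graded Leibniz rule (only the case of a left factor of degree zero matters here) and has
`D ∘ D = 0`. -/
theorem differential_eta (N : ℕ) (q a : ℝ) (D : SigmaForms N q a →ₗ[ℂ] SigmaForms N q a)
    (hd : ∀ x, D (toSigma N q a (fnT N q x)) = toSigma N q a (formT N q (d N q x)))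
    (hL : ∀ x ω, D (toSigma N q a (fnT N q x) * ω) =
      D (toSigma N q a (fnT N q x)) * ω + toSigma N q a (fnT N q x) * D ω)
    (hDD : ∀ ω, D (D ω) = 0) :
    D (toSigma N q a (formT N q (eta N q))) = dEta N q a := by
  have key : ∀ k l : Fin N, D (toSigma N q a (formT N q (lact ((metric N q k l : ℂ) •
      Sphere.x N q k) (d N q (Sphere.x N q l))))) = (metric N q k l : ℂ) •
      (toSigma N q a (formT N q (d N q (Sphere.x N q k)))
        * toSigma N q a (formT N q (d N q (Sphere.x N q l)))) := by
    intro k l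
    rw [formT_lact, fnT_smul, smul_mul_assoc, map_smul, map_smul, map_mul, hL, hd,
      ← hd (Sphere.x N q l), hDD, mul_zero, add_zero]
  simp only [eta, dEta, map_sum, key]

/-- The higher order calculus `Γ^∧_{σ0}`: the quotient of `Γ^∧_σ` by the additional relation
`dη = 0`. -/
abbrev SigmaZeroForms (N : ℕ) (q a : ℝ) : Type :=
  RingQuot fun ω τ : SigmaForms N q a => ω = dEta N q a ∧ τ = 0

/-- The projection `Γ^∧_σ → Γ^∧_{σ0}`. -/
def toSigmaZero (N : ℕ) (q a : ℝ) : SigmaForms N q a →ₐ[ℂ] SigmaZeroForms N q a :=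
  RingQuot.mkAlgHom ℂ _

/-- The map `X → Γ^∧_{σ0}`, by which `Γ^∧_{σ0}` is a left `X`-module. -/
def fn (N : ℕ) (q a : ℝ) : Sphere N q →+* SigmaZeroForms N q a :=
  ((toSigmaZero N q a).comp (toSigma N q a)).toRingHom.comp (fnT N q)

/-- The map `Γ → Γ^∧_{σ0}`. -/
def form (N : ℕ) (q a : ℝ) (θ : OneForms N q) : SigmaZeroForms N q a :=
  toSigmaZero N q a (toSigma N q a (formT N q θ))

instance (N : ℕ) (q a : ℝ) : Module (Sphere N q) (SigmaZeroForms N q a) :=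
  Module.compHom _ (fn N q a)

/-- The product `θ_1 ∧ ⋯ ∧ θ_s` in `Γ^∧_{σ0}` of one-forms (`1` if `s = 0`). -/
def wedge (N : ℕ) (q a : ℝ) {s : ℕ} (θ : Fin s → OneForms N q) : SigmaZeroForms N q a :=
  (List.ofFn fun r => form N q a (θ r)).prod

/-- The component of degree `n` of `Γ^∧_{σ0}`: the forms of order `n`. -/
def formsOfOrder (N : ℕ) (q a : ℝ) (n : ℕ) : Submodule (Sphere N q) (SigmaZeroForms N q a) :=
  Submodule.span (Sphere N q) (Set.range fun θ : Fin n → OneForms N q => wedge N q a θ)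

end QuantumSphere

end

noncomputable section

namespace QuantumSphere

/-! The arrays `c` with `c · q R̂⁻ = c` are the left eigenvectors of `R̂⁻` for the eigenvalue `q⁻¹`,
and the corresponding combinations of `γ_i γ_j` lie in the kernel of `id - σ`. On the remaining
eigenspaces `R̂⁻` has the eigenvalues `-q` and `q^{N-1}`, the latter spanned by the metric. Hence in
the quotient `R̂⁻ γγ = -q γγ + formCoeff · C · G`, where `G = C^{kl} γ_k γ_l`
(`SphereForms.rMatInv_gam`, from `rMatInv_sq` and `sum_metric_mul_rMatInv`).

The heart of the proof is that `dη = 0` forces `G = 0` (`SphereForms.sum_gam_mul_gam`). Put `P =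
C^{kl} x_k η γ_l`. Three linear relations connect `G`, `P` and `η²`: one from `η x_j = A dx_j + x_j
η` (`SphereForms.eta_mul`), one from moving `R̂⁻` between `xx` and `γγ` inside a nested contraction
(`SphereForms.nested_contraction`), and one from `dη = 0` itself. Eliminating `P` and `η²` leaves a
multiple of `G` whose factor does not vanish for `a = α^±` (`deta_coeff_ne_zero`).

Now `R̂⁻ γγ = -q γγ`, the relations of a quantum exterior algebra. They write each `γ_i γ_j` with `j
≤ i` through products whose first index is smaller than `i` (`mul_mem_span_of_le`), so every word
reduces, by descent in the lexicographic order, to strictly increasing words of the same length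
(`word_mem_span`); these have length at most `N`. Finally the `γ_i` generate `Γ` as a left module
because `1 + a ≠ 0` (`leftSpan_gam`), so all functions can be moved to the left and the words in the
`γ_i` generate everything (`wordSpan_eq_top`). -/

/-- The weight `q^{-ϱ_i}`, i.e. the nonzero entry of the metric in row `i`. -/
def wt (N : ℕ) (q : ℝ) (i : Fin N) : ℝ := q ^ (-rho N i)

theorem metric_eq (N : ℕ) (q : ℝ) (i j : Fin N) :
    metric N q i j = if j = i.rev then wt N q i else 0 := by
  unfold metric wt
  congr 1
  rw [eq_iff_iff]
  constructor <;> rintro rfl <;> simp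

theorem rho_rev (N : ℕ) (i : Fin N) : rho N i.rev = -rho N i := by
  have hi := i.isLt
  have hc : (((i.rev : Fin N) : ℕ) : ℝ) = (N : ℝ) - ((i : ℕ) + 1) := by
    rw [Fin.val_rev, Nat.cast_sub (by omega)]; push_cast; ring
  unfold rho
  rw [hc, Fin.val_rev]
  rcases lt_trichotomy (2 * ((i : ℕ) + 1)) (N + 1) with h | h | h
  · rw [if_neg (by omega), if_neg (by omega), if_pos h]; ring
  · rw [if_neg (by omega), if_pos (by omega), if_neg (by omega), if_pos h]; ring
  · rw [if_pos (by omega), if_neg (by omega), if_neg (by omega)]; ring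

/-! ### Metric weights and the tails of their sum of squares. -/

section Weights
variable {N : ℕ} {q : ℝ}

theorem wt_pos (hq : 0 < q) (i : Fin N) : 0 < wt N q i := Real.rpow_pos_of_pos hq _

theorem wt_ne_zero (hq : 0 < q) (i : Fin N) : wt N q i ≠ 0 := (wt_pos hq i).ne'

theorem wt_mul_rev (hq : 0 < q) (i : Fin N) : wt N q i * wt N q i.rev = 1 := by
  rw [wt, wt, ← Real.rpow_add hq, rho_rev]; simp

theorem wt_rev (hq : 0 < q) (i : Fin N) : wt N q i.rev = (wt N q i)⁻¹ :=
  eq_inv_of_mul_eq_one_right (wt_mul_rev hq i)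

theorem wt_of_eq_rev (i : Fin N) (h : i = i.rev) : wt N q i = 1 := by
  have h1 := rho_rev N i
  rw [← h] at h1
  rw [wt, show rho N i = 0 by linarith]; simp

theorem wt_sq (hq : 0 < q) (i : Fin N) : wt N q i ^ 2 =
    q ^ (if 2 * ((i : ℕ) + 1) < N + 1 then 2 * ((i : ℤ) + 1) - N
      else if 2 * ((i : ℕ) + 1) = N + 1 then 0 else 2 * ((i : ℤ) + 1) - N - 2 : ℤ) := by
  rw [wt, ← Real.rpow_natCast, ← Real.rpow_mul hq.le, ← Real.rpow_intCast]
  congr 1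
  unfold rho
  split_ifs <;> push_cast <;> ring

theorem lt_rev_iff (i : Fin N) : i < i.rev ↔ 2 * ((i : ℕ) + 1) < N + 1 := by
  rw [Fin.lt_def, Fin.val_rev]; omega

theorem eq_rev_iff (i : Fin N) : i = i.rev ↔ 2 * ((i : ℕ) + 1) = N + 1 := by
  rw [Fin.ext_iff, Fin.val_rev]; omega

/-- The tails of the sum of the squared weights. -/
theorem sum_wt_sq_Ioi (hq : 0 < q) (l : Fin N) :
    (q - q⁻¹) * ∑ i ∈ Finset.Ioi l, wt N q i ^ 2 = q ^ ((N : ℤ) - 1)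
      + (if l < l.rev then q - q⁻¹ else 0) - (if l = l.rev then 1 else q) * wt N q l ^ 2 := by
  have hq0 : q ≠ 0 := hq.ne'
  -- Induction on the number `m` of indices after `l`. On either side of the middle the squared
  -- weights form a geometric progression with ratio `q²`, so the sum telescopes; the conditional
  -- terms compensate for the shorter steps in the middle.
  obtain ⟨m, hm⟩ : ∃ m, N = l + 1 + m := ⟨N - (l + 1), by omega⟩
  induction m generalizing l with
  | zero =>
    have : Finset.Ioi l = ∅ := by
      ext i; simp only [Finset.mem_Ioi, Finset.notMem_empty, iff_false, not_lt, Fin.le_def]; omega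
    rw [this, Finset.sum_empty, wt_sq hq]
    simp only [lt_rev_iff, eq_rev_iff]
    rcases lt_trichotomy (2 * ((l : ℕ) + 1)) (N + 1) with h | h | h
    · omega
    · have hN : N = 1 := by omega
      rw [if_neg (by omega), if_pos h, if_neg (by omega), if_pos h, hN]; simp
    · rw [if_neg (by omega), if_neg (by omega), if_neg (by omega), if_neg (by omega),
        ← zpow_one_add₀ hq0]
      rw [show (1 : ℤ) + (2 * ((l : ℤ) + 1) - N - 2) = N - 1 by omega]; ring
  | succ m ih =>
    let l1 : Fin N := ⟨l + 1, by omega⟩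
    have h1 : (l1 : ℕ) = l + 1 := rfl
    have hI : Finset.Ioi l = insert l1 (Finset.Ioi l1) := by
      ext i; simp only [Finset.mem_insert, Finset.mem_Ioi, Fin.lt_def, Fin.ext_iff]; omega
    rw [hI, Finset.sum_insert (by simp), mul_add, ih l1 (by omega), wt_sq hq l, wt_sq hq l1]
    simp only [lt_rev_iff, eq_rev_iff, h1]
    rcases lt_trichotomy (2 * ((l : ℕ) + 1)) (N + 1) with h | h | h
    · rcases lt_trichotomy (2 * ((l : ℕ) + 1 + 1)) (N + 1) with h' | h' | h'
      · simp only [h, h', h.ne, h'.ne, if_true, if_false]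
        rw [show (2 * (((l + 1 : ℕ) : ℤ) + 1) - N) = (2 * ((l : ℤ) + 1) - N) + 1 + 1 by
          push_cast; ring, zpow_add_one₀ hq0, zpow_add_one₀ hq0]
        field_simp; ring
      · simp only [h, h', h.ne, lt_irrefl, if_true, if_false]
        rw [show (2 * ((l : ℤ) + 1) - N) = -1 by omega]
        simp [hq0]; ring
      · simp only [h, h'.not_gt, h.ne, h'.ne', if_true, if_false]
        rw [show (2 * (((l + 1 : ℕ) : ℤ) + 1) - N - 2) = 0 by omega,
          show (2 * ((l : ℤ) + 1) - N) = 0 by omega]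
        simp; ring
    · have h' : N + 1 < 2 * ((l : ℕ) + 1 + 1) := by omega
      simp only [h, h'.not_gt, h'.ne', lt_irrefl, if_true, if_false]
      rw [show (2 * (((l + 1 : ℕ) : ℤ) + 1) - N - 2) = 1 by omega]
      simp; field_simp; ring
    · have h' : N + 1 < 2 * ((l : ℕ) + 1 + 1) := by omega
      simp only [h.not_gt, h.ne', h'.not_gt, h'.ne', if_false]
      rw [show (2 * (((l + 1 : ℕ) : ℤ) + 1) - N - 2) = (2 * ((l : ℤ) + 1) - N - 2) + 1 + 1 by
          push_cast; ring, zpow_add_one₀ hq0, zpow_add_one₀ hq0]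
      field_simp; ring

end Weights

/-! ### Entries of `R̂⁻` and its compatibility with the metric. -/

section RMatrix
variable {N : ℕ} {q : ℝ}

theorem sum_metric_smul {V : Type*} [AddCommGroup V] [Module ℝ V] (v : Fin N → Fin N → V) :
    ∑ k, ∑ l, metric N q k l • v k l = ∑ k, wt N q k • v k k.rev := by
  simp only [metric_eq, ite_smul, zero_smul, Finset.sum_ite_eq',
    Finset.mem_univ, if_true]

/-- The coefficient of the permuted indices in `R̂⁻`. -/
def swapCoeff (N : ℕ) (q : ℝ) (i j : Fin N) : ℝ :=
  if i = j then (if i = j.rev then 1 else q⁻¹) else if i = j.rev then q else 1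

theorem rMat_eq (k l i j : Fin N) : rMat N q k l i j =
    (if l = i then if k = j then (swapCoeff N q i j)⁻¹ else 0 else 0)
      + (q - q⁻¹) * (if i < l then (if k = i then if l = j then 1 else 0 else 0)
        - kMat N q k l i j else 0) := by
  unfold rMat swapCoeff
  congr 1
  · by_cases h : i = l ∧ j = k
    · obtain ⟨rfl, rfl⟩ := h
      have : (j = i.rev) ↔ (i = j.rev) := by constructor <;> rintro rfl <;> simp
      have hc : j = i ↔ i = j := eq_comm
      simp only [this, hc, and_self, if_true, mul_one]
      split_ifs <;> simp
    · rw [if_neg h, mul_zero, ← ite_and, if_neg (by tauto)]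
  · congr 1
    simp only [← ite_and, eq_comm (a := i), eq_comm (a := j)]

/-- Subtracting `(q - q⁻¹)(I - K)` cancels the part of `R̂` with `i < l` and leaves `-(q - q⁻¹)(I -
K)` where `l ≤ i`. Its entries with `l = i` merge with the permutation term and invert the
coefficient there. -/
theorem rMatInv_eq (hq : 0 < q) (k l i j : Fin N) : rMatInv N q k l i j =
    (if l = i then if k = j then swapCoeff N q i j else 0 else 0)
      - (q - q⁻¹) * (if k = i then if l = j then if j < i then 1 else 0 else 0 else 0)
      + (q - q⁻¹) * (if l < i then if k = l.rev then (if j = i.rev then wt N q i else 0) * wt N q k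
          else 0 else 0) := by
  have hK : kMat N q k l i j =
      if k = l.rev then (if j = i.rev then wt N q i else 0) * wt N q k else 0 := by
    have : l = k.rev ↔ k = l.rev := by constructor <;> rintro rfl <;> simp
    rw [kMat, metric_eq, metric_eq, mul_ite, mul_zero, if_congr this rfl rfl]
  rw [rMatInv, rMat_eq, hK]
  rcases lt_trichotomy i l with h | h | h
  · have : ¬ (k = i ∧ l = j ∧ j < i) := by rintro ⟨rfl, rfl, h'⟩; exact absurd h h'.not_gt
    simp only [← ite_and, this]
    simp only [h, h.ne', h.not_gt, if_true, if_false, false_and]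
    ring
  · subst h
    by_cases hkj : k = j
    · subst hkj
      simp only [lt_irrefl, if_true, if_false, mul_zero, add_zero]
      by_cases hk : k = i
      · subst hk
        by_cases hr : k = k.rev
        · simp [← hr, swapCoeff, wt_of_eq_rev k hr]
        · simp [hr, swapCoeff]
      · by_cases hr : k = i.rev
        · have := wt_mul_rev hq i
          subst hr
          simp only [hk, if_false, if_true, this, swapCoeff, Ne.symm hk, Fin.rev_rev]
          simp
        · have hr' : ¬ i = k.rev := by rintro rfl; simp at hr
          simp [hk, hr, hr', swapCoeff, Ne.symm hk]
    · have h1 : ¬ (k = i ∧ i = j) := by rintro ⟨rfl, rfl⟩; exact hkj rfl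
      have h2 : ¬ (k = i ∧ i = j ∧ j < i) := by tauto
      simp only [hkj, lt_irrefl, if_true, if_false, h1, h2, ← ite_and]
      by_cases hk : k = i.rev
      · have : ¬ j = i.rev := fun h => hkj (hk.trans h.symm)
        simp [this]
      · simp [hk]
  · have : (k = i ∧ l = j ∧ j < i) ↔ (k = i ∧ l = j) := by
      constructor
      · tauto
      · rintro ⟨rfl, rfl⟩; exact ⟨rfl, rfl, h⟩
    simp only [← ite_and, this]
    simp only [h, h.ne, h.not_gt, if_false, false_and, true_and]
    ring

/-- `R̂⁻` acting on arrays. -/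
theorem sum_rMatInv_smul (hq : 0 < q) {V : Type*} [AddCommGroup V] [Module ℝ V]
    (v : Fin N → Fin N → V) (i j : Fin N) :
    ∑ k, ∑ l, rMatInv N q k l i j • v k l = swapCoeff N q i j • v j i
      - (q - q⁻¹) • (if j < i then v i j else 0)
      + ((q - q⁻¹) * (if j = i.rev then wt N q i else 0)) •
        ∑ l ∈ Finset.Iio i, wt N q l.rev • v l.rev l := by
  simp only [rMatInv_eq hq, add_smul, sub_smul, Finset.sum_add_distrib, Finset.sum_sub_distrib]
  congr 1
  · congr 1
    · simp only [ite_smul, zero_smul, Finset.sum_ite_eq', Finset.mem_univ, if_true]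
    · simp only [mul_ite, mul_one, mul_zero, ite_smul, zero_smul]
      rw [Finset.sum_eq_single i (by intro b _ hb; simp [hb]) (by simp)]
      by_cases h : j < i <;> simp [h, sub_smul]
  · rw [Finset.sum_comm, Finset.smul_sum, ← Finset.sum_filter_add_sum_filter_not _ (· < i)]
    rw [Finset.sum_eq_zero (s := Finset.univ.filter fun x => ¬ x < i), add_zero]
    · refine Finset.sum_congr (by ext; simp) fun l hl => ?_
      rw [Finset.mem_Iio] at hl
      simp only [hl, if_true, mul_ite, mul_zero, ite_smul, zero_smul, Finset.sum_ite_eq',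
        Finset.mem_univ]
      split_ifs
      · rw [smul_smul, mul_assoc]
      · simp
    · intro l hl
      simp only [Finset.mem_filter] at hl
      simp [hl.2]

/-- Crossing relation: turning a pair of indices with the metric exchanges `R̂⁻` and `R̂`, the `I`
term of one matching the `K` term of the other. In the computation of `η x_j` it makes the matrix
act on a product of two functions. -/
theorem wt_mul_rMatInv (hq : 0 < q) (j k s t : Fin N) :
    wt N q k * rMatInv N q s t k.rev j = rMat N q k s j t.rev * wt N q t.rev := by
  have hk := wt_mul_rev hq k
  have hr : ∀ a b : Fin N, a = b.rev ↔ b = a.rev := by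
    intro a b; constructor <;> rintro rfl <;> simp
  have e1 : wt N q k * (if t = k.rev then if s = j then swapCoeff N q k.rev j else 0 else 0) =
      (if s = j then if k = t.rev then (swapCoeff N q j t.rev)⁻¹ else 0 else 0) * wt N q t.rev := by
    by_cases h : t = k.rev ∧ s = j
    · obtain ⟨rfl, rfl⟩ := h
      simp only [if_true, Fin.rev_rev, swapCoeff, Fin.rev_inj]
      simp only [eq_comm (a := s)]
      simp only [hr s k, eq_comm (a := k.rev)]
      split_ifs <;> simp [mul_comm]
    · have : ¬ (s = j ∧ k = t.rev) := by rw [hr k t]; tauto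
      simp only [← ite_and, h, this, if_false, mul_zero, zero_mul]
  have e2 : wt N q k * (if s = k.rev then if t = j then if j < k.rev then 1 else 0 else 0 else 0) =
      (if j < s then kMat N q k s j t.rev else 0) * wt N q t.rev := by
    rw [kMat, metric_eq, metric_eq]
    by_cases h : s = k.rev ∧ t = j
    · obtain ⟨rfl, rfl⟩ := h
      have ht := wt_mul_rev hq t
      simp only [if_true]
      split_ifs
      · linear_combination (-wt N q k) * ht
      · simp
    · simp only [Fin.rev_inj]
      split_ifs <;> simp_all
  have e3 : wt N q k * (if t < k.rev then if s = t.rev then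
        (if j = k.rev.rev then wt N q k.rev else 0) * wt N q s else 0 else 0) =
      (if j < s then if k = j then if s = t.rev then 1 else 0 else 0 else 0) * wt N q t.rev := by
    rw [Fin.rev_rev]
    by_cases h : s = t.rev ∧ k = j
    · obtain ⟨rfl, rfl⟩ := h
      have : t < k.rev ↔ k < t.rev := by rw [← Fin.rev_lt_rev, Fin.rev_rev]
      simp only [this, if_true]
      split_ifs
      · linear_combination (wt N q t.rev) * hk
      · simp
    · simp only [eq_comm (a := j) (b := k)]
      split_ifs <;> simp_all
  rw [rMatInv_eq hq, rMat_eq]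
  rw [show (if j < s then (if k = j then if s = t.rev then (1:ℝ) else 0 else 0)
      - kMat N q k s j t.rev else 0) =
      (if j < s then if k = j then if s = t.rev then (1:ℝ) else 0 else 0 else 0) -
      (if j < s then kMat N q k s j t.rev else 0) by split_ifs <;> simp]
  linear_combination e1 - (q - q⁻¹) * e2 + (q - q⁻¹) * e3

/-- Turning both pairs of indices sends `R̂⁻` to its transpose with reversed indices, and here the
three terms match one by one. This is what carries `R̂⁻` from `xx` over to `γγ`. -/
theorem wt_mul_wt_mul_rMatInv (hq : 0 < q) (k s u v : Fin N) :
    wt N q k * wt N q s * rMatInv N q u v s k =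
      rMatInv N q k.rev s.rev v.rev u.rev * (wt N q v * wt N q u) := by
  have hr : ∀ a b : Fin N, a = b.rev ↔ b = a.rev := by
    intro a b; constructor <;> rintro rfl <;> simp
  rw [rMatInv_eq hq, rMatInv_eq hq]
  simp only [Fin.rev_inj, Fin.rev_rev, Fin.rev_lt_rev]
  have e1 : wt N q k * wt N q s * (if v = s then if u = k then swapCoeff N q s k else 0 else 0) =
      (if s = v then if k = u then swapCoeff N q v.rev u.rev else 0 else 0)
        * (wt N q v * wt N q u) := by
    by_cases h : s = v ∧ k = u
    · obtain ⟨rfl, rfl⟩ := h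
      simp only [if_true, swapCoeff, Fin.rev_inj, Fin.rev_rev]
      simp only [eq_comm (a := s.rev), hr k s]
      ring
    · have : ¬ (v = s ∧ u = k) := by tauto
      simp only [← ite_and, h, this, if_false, mul_zero, zero_mul]
  have e2 : wt N q k * wt N q s *
        (if u = s then if v = k then if k < s then 1 else 0 else 0 else 0) =
      (if k = v then if s = u then if v < u then 1 else 0 else 0 else 0)
        * (wt N q v * wt N q u) := by
    by_cases h : k = v ∧ s = u
    · obtain ⟨rfl, rfl⟩ := h
      simp only [if_true]
      split_ifs <;> ring
    · have : ¬ (u = s ∧ v = k) := by tauto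
      have h2 : ¬ (k = v ∧ s = u ∧ v < u) := by tauto
      have h3 : ¬ (u = s ∧ v = k ∧ k < s) := by tauto
      simp only [← ite_and, h2, h3, if_false, mul_zero, zero_mul]
  have e3 : wt N q k * wt N q s * (if v < s then if u = v.rev then
        (if k = s.rev then wt N q s else 0) * wt N q u else 0 else 0) =
      (if v < s then if k.rev = s then (if u.rev = v then wt N q v.rev else 0) * wt N q k.rev
        else 0 else 0) * (wt N q v * wt N q u) := by
    by_cases h : k = s.rev ∧ u = v.rev
    · obtain ⟨rfl, rfl⟩ := h
      have hs := wt_mul_rev hq s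
      have hv := wt_mul_rev hq v
      simp only [if_true, Fin.rev_rev]
      split_ifs
      · linear_combination (wt N q s * wt N q v.rev) * (hs - hv)
      · simp
    · have h' : ¬ (k.rev = s ∧ u.rev = v) := by
        rw [eq_comm (a := k.rev), hr s k, eq_comm (a := u.rev), hr v u]; exact h
      split_ifs <;> simp_all
  linear_combination e1 - (q - q⁻¹) * e2 + (q - q⁻¹) * e3

end RMatrix

/-! ### Spectral relations of `R̂⁻`. -/

section RMatrix
variable {N : ℕ} {q : ℝ}

theorem swapCoeff_rev (i : Fin N) : swapCoeff N q i i.rev = if i = i.rev then 1 else q := by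
  simp [swapCoeff]

/-- The index set is kept arbitrary: the full sum gives the eigenvalue of the metric, while the
square of `R̂⁻` requires a tail. -/
theorem sum_wt_mul_rMatInv (hq : 0 < q) (l : Fin N) (S : Finset (Fin N)) :
    ∑ j ∈ S, wt N q j * rMatInv N q l.rev l j j.rev =
      (if l ∈ S then wt N q l * (if l = l.rev then 1 else q) else 0)
      - (q - q⁻¹) * (if l.rev ∈ S then if l < l.rev then wt N q l.rev else 0 else 0)
      + (q - q⁻¹) * (wt N q l.rev * ∑ j ∈ S.filter (l < ·), wt N q j ^ 2) := by
  simp only [rMatInv_eq hq, if_true, mul_add, mul_sub, Finset.sum_add_distrib,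
    Finset.sum_sub_distrib, swapCoeff_rev]
  congr 1
  · congr 1
    · rw [← Finset.sum_ite_eq S l fun l => wt N q l * (if l = l.rev then 1 else q)]
      refine Finset.sum_congr rfl fun j _ => ?_
      by_cases h : l = j
      · subst h; simp
      · simp [h]
    · rw [← Finset.sum_ite_eq S l.rev fun j => if l < l.rev then wt N q j else 0, Finset.mul_sum]
      refine Finset.sum_congr rfl fun j _ => ?_
      by_cases h : l.rev = j
      · subst h; simp; split_ifs <;> ring
      · simp [h]
  · rw [Finset.sum_filter, Finset.mul_sum, Finset.mul_sum]
    refine Finset.sum_congr rfl fun j _ => ?_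
    split_ifs <;> ring

theorem rMatInv_eq_zero (hq : 0 < q) (k l j : Fin N) (h : k ≠ l.rev) :
    rMatInv N q k l j j.rev = 0 := by
  have h1 : ¬ (l = j ∧ k = j.rev) := by rintro ⟨rfl, rfl⟩; exact h rfl
  have h2 : ¬ (k = j ∧ l = j.rev ∧ j.rev < j) := by rintro ⟨rfl, rfl, _⟩; simp at h
  rw [rMatInv_eq hq]
  simp [← ite_and, h1, h2, h]

/-- The metric is an eigenvector of `R̂⁻` with eigenvalue `q^{N-1}`. -/
theorem sum_metric_mul_rMatInv (hq : 0 < q) (k l : Fin N) :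
    ∑ i, ∑ j, metric N q i j * rMatInv N q k l i j = q ^ ((N : ℤ) - 1) * metric N q k l := by
  have := sum_metric_smul (q := q) fun i j => rMatInv N q k l i j
  simp only [smul_eq_mul] at this
  rw [this, metric_eq]
  have hr : l = k.rev ↔ k = l.rev := by constructor <;> rintro rfl <;> simp
  rw [if_congr hr rfl rfl]
  by_cases h : k = l.rev
  · subst h
    have hS := sum_wt_sq_Ioi hq l
    have hl := wt_mul_rev hq l
    rw [sum_wt_mul_rMatInv hq]
    rw [show Finset.univ.filter (l < ·) = Finset.Ioi l by ext; simp]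
    simp only [Finset.mem_univ, if_true]
    generalize (if l = l.rev then 1 else q) = e at *
    split_ifs at hS ⊢ <;>
    linear_combination wt N q l.rev * hS - wt N q l * e * hl
  · rw [Finset.sum_eq_zero fun j _ => by rw [rMatInv_eq_zero hq _ _ _ h, mul_zero], if_neg h,
      mul_zero]

/-- The quadratic relation of `R̂⁻` modulo `K`. -/
theorem rMatInv_sq (hq : 0 < q) (i j k l : Fin N) :
    ∑ a, ∑ b, rMatInv N q a b i j * rMatInv N q k l a b =
      (if k = i then if l = j then 1 else 0 else 0) - (q - q⁻¹) * rMatInv N q k l i j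
        + (q - q⁻¹) * q ^ ((N : ℤ) - 1) * kMat N q k l i j := by
  have hq0 := hq.ne'
  have := sum_rMatInv_smul hq (fun a b => rMatInv N q k l a b) i j
  simp only [smul_eq_mul] at this
  rw [this]
  by_cases hij : j = i.rev
  · subst hij
    by_cases h : k = l.rev
    · subst h
      -- Reversing the index turns the partial sum produced by the `K` term into a tail, to which
      -- `sum_wt_mul_rMatInv` applies.
      have hre : ∑ b ∈ Finset.Iio i, wt N q b.rev * rMatInv N q l.rev l b.rev b =
          ∑ a ∈ Finset.Ioi i.rev, wt N q a * rMatInv N q l.rev l a a.rev := by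
        refine Finset.sum_nbij' Fin.rev Fin.rev ?_ ?_ ?_ ?_ ?_ <;> simp [Fin.rev_lt_iff, Fin.lt_rev_iff]
      have hS := sum_wt_sq_Ioi hq l
      have hT := sum_wt_sq_Ioi hq i.rev
      have hl := wt_rev hq l
      have hi := wt_rev hq i
      have hl0 := wt_ne_zero hq l
      have hi0 := wt_ne_zero hq i
      rw [hre, sum_wt_mul_rMatInv hq, rMatInv_eq hq, rMatInv_eq hq, kMat, metric_eq, metric_eq]
      simp only [if_true, Fin.rev_rev, Finset.mem_Ioi, swapCoeff, Fin.rev_inj, hl, hi] at hS hT ⊢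
      have hF : (Finset.Ioi i.rev).filter (l < ·) =
          if l < i.rev then Finset.Ioi i.rev else Finset.Ioi l := by
        ext x; split_ifs with h <;>
        simp only [Finset.mem_filter, Finset.mem_Ioi, Fin.lt_def] at * <;> omega
      rw [hF, apply_ite (fun s : Finset (Fin N) => ∑ j ∈ s, wt N q j ^ 2)]
      generalize ∑ j ∈ Finset.Ioi i.rev, wt N q j ^ 2 = T at *
      generalize ∑ j ∈ Finset.Ioi l, wt N q j ^ 2 = S at *
      have hli := l.isLt
      have hii := i.isLt
      have hwi : 2 * ((i : ℕ) + 1) = N + 1 → wt N q i = 1 := fun h =>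
        wt_of_eq_rev i ((eq_rev_iff i).2 h)
      have hwl : 2 * ((l : ℕ) + 1) = N + 1 → wt N q l = 1 := fun h =>
        wt_of_eq_rev l ((eq_rev_iff l).2 h)
      have hw : (l : ℕ) = i → wt N q l = wt N q i := fun h => by rw [Fin.ext h]
      have hw' : (l : ℕ) = N - (i + 1) → wt N q l = (wt N q i)⁻¹ := fun h => by
        rw [← hi, show l = i.rev from Fin.ext (by rw [Fin.val_rev]; exact h)]
      clear hre hF this hl hi
      simp only [Fin.lt_def, Fin.ext_iff, Fin.val_rev] at hS hT ⊢
      generalize wt N q i = u at *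
      generalize wt N q l = v at *
      generalize q ^ ((N : ℤ) - 1) = z at *
      -- All conditionals are decided by the positions of `i` and `l` relative to the middle and of
      -- `l` relative to `i` and `i'`. Each possible case is a multiple of a tail identity, `hS` at
      -- `l` or `hT` at `i'`.
      rcases lt_trichotomy (2 * ((i : ℕ) + 1)) (N + 1) with a1 | a1 | a1 <;>
      rcases lt_trichotomy (2 * ((l : ℕ) + 1)) (N + 1) with a2 | a2 | a2 <;>
      rcases lt_trichotomy (l : ℕ) i with a3 | a3 | a3 <;>
      rcases lt_trichotomy (l : ℕ) (N - (i + 1)) with a4 | a4 | a4 <;>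
      first
      | (exfalso; omega)
      | (simp (disch := omega) only [if_pos, if_neg] at hS hT ⊢
         try simp only [hwi a1] at hS hT ⊢
         try simp only [hwl a2] at hS hT ⊢
         try simp only [hw a3] at hS hT ⊢
         try simp only [hw' a4] at hS hT ⊢
         first
         | linear_combination (norm := (field_simp; ring1)) ((q - q⁻¹) * u * v⁻¹) * hT
         | linear_combination (norm := (field_simp; ring1)) ((q - q⁻¹) * u * v⁻¹) * hS
         | linear_combination (norm := (field_simp; ring1)) (q - q⁻¹) * hT
         | linear_combination (norm := (field_simp; ring1)) (q - q⁻¹) * hS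
         | linear_combination (norm := (field_simp; ring1)) ((q - q⁻¹) * u ^ 2) * hT
         | linear_combination (norm := (field_simp; ring1)) ((q - q⁻¹) * u ^ 2) * hS
         | linear_combination (norm := (field_simp; ring1)) ((q - q⁻¹) * u) * hT
         | linear_combination (norm := (field_simp; ring1)) ((q - q⁻¹) * u) * hS
         | linear_combination (norm := (field_simp; ring1)) ((q - q⁻¹) * v⁻¹) * hT
         | linear_combination (norm := (field_simp; ring1)) ((q - q⁻¹) * v⁻¹) * hS)
    · have h1 := rMatInv_eq_zero hq k l i h
      have h2 := rMatInv_eq_zero hq k l i.rev h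
      rw [Fin.rev_rev] at h2
      have h3 : ¬ (k = i ∧ l = i.rev) := by rintro ⟨rfl, rfl⟩; simp at h
      have h4 : l ≠ k.rev := by rintro rfl; simp at h
      rw [h1, h2, Finset.sum_eq_zero, kMat, metric_eq, metric_eq, ← ite_and, if_neg h3, if_neg h4]
      · simp
      · intro b _
        have := rMatInv_eq_zero hq k l b.rev h
        rw [Fin.rev_rev] at this
        rw [this, mul_zero]
  -- For `j ≠ i'` the `K` terms vanish, and what remains is a Hecke relation on the pairs `(i, j)`
  -- and `(j, i)`.
  · have hji : i ≠ j.rev := by rintro rfl; simp at hij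
    rw [rMatInv_eq hq, rMatInv_eq hq, kMat, metric_eq N q i j]
    simp only [hij, hji, swapCoeff, if_false, mul_zero, zero_mul, add_zero, ite_self]
    rcases lt_trichotomy i j with h | h | h
    · simp only [h, h.ne, h.ne', h.not_gt, if_true, if_false]
      by_cases h1 : k = i <;> by_cases h2 : l = j <;> simp [h1, h2, h.ne, h.ne', ← ite_and, and_comm]
    · subst h
      simp only [lt_irrefl, if_true, if_false]
      by_cases h1 : k = i <;> by_cases h2 : l = i <;> simp [h1, h2]
      field_simp; ring
    · simp only [h, h.ne, h.ne', h.not_gt, if_true, if_false]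
      by_cases h1 : k = i <;> by_cases h2 : l = j <;> simp [h1, h2]

end RMatrix

/-! ### Scalar identities and nonvanishing of the constants. -/

/-- The coefficient of `K` in the relations of the sphere. -/
def sphereCoeff (N : ℕ) (q : ℝ) : ℝ :=
  (q ^ ((N : ℤ) - 1) - q ^ ((N : ℤ) - 3)) / (1 + q ^ ((N : ℤ) - 2))

/-- The coefficient of `K` in the quadratic relations of the one-forms `γ_i`. -/
def formCoeff (N : ℕ) (q : ℝ) : ℝ :=
  (q - q⁻¹) * q ^ ((N : ℤ) - 1) / (q ^ ((N : ℤ) - 1) - q⁻¹)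

/-- The coefficient in `η x_j = A dx_j + x_j η`. -/
def etaCoeff (N : ℕ) (q : ℝ) : ℝ :=
  (1 - q) * (1 - q ^ ((N : ℤ) - 1)) / (q * (1 + q ^ ((N : ℤ) - 2)))

section Constants
variable {N : ℕ} {q : ℝ}

theorem zpow_ne_one (hq : 0 < q) (hq1 : q ≠ 1) {n : ℤ} (hn : n ≠ 0) : q ^ n ≠ 1 := by
  rw [Ne, zpow_eq_one_iff_right₀ hq.le hq1]
  exact hn

theorem zpow_sub_one_eq (hq : 0 < q) : q ^ ((N : ℤ) - 1) = q ^ ((N : ℤ) - 2) * q := by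
  rw [← zpow_add_one₀ hq.ne']; congr 1; ring

theorem zpow_sub_three_eq (hq : 0 < q) : q ^ ((N : ℤ) - 3) = q ^ ((N : ℤ) - 2) * q⁻¹ := by
  rw [← zpow_sub_one₀ hq.ne']; congr 1; ring

theorem zpow_eq_mul_sq (hq : 0 < q) : q ^ (N : ℤ) = q ^ ((N : ℤ) - 2) * q ^ 2 := by
  rw [pow_two, ← mul_assoc, ← zpow_add_one₀ hq.ne', ← zpow_add_one₀ hq.ne']; congr 1; ring

theorem one_sub_zpow_ne_zero (hN : 3 ≤ N) (hq : 0 < q) (hq1 : q ≠ 1) :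
    1 - q ^ ((N : ℤ) - 2) * q ≠ 0 := by
  rw [← zpow_sub_one_eq hq, sub_ne_zero]
  exact (zpow_ne_one hq hq1 (by omega)).symm

theorem zpow_sub_one_ne_zero (hN : 3 ≤ N) (hq : 0 < q) (hq1 : q ≠ 1) :
    q ^ ((N : ℤ) - 2) * q ^ 2 - 1 ≠ 0 := by
  rw [← zpow_eq_mul_sq hq, sub_ne_zero]
  exact zpow_ne_one hq hq1 (by omega)

/-- This collects the coefficient of `dx_j` in `η x_j`: `sphereCoeff - q + q⁻¹` is the metric part
of `R̂` on `xx`, and `q - 1` comes from the term `x_i dx_j`. -/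
theorem etaCoeff_eq (hq : 0 < q) :
    sphereCoeff N q - q + q⁻¹ + (q - 1) = etaCoeff N q := by
  have hz := zpow_pos hq ((N : ℤ) - 2)
  rw [sphereCoeff, etaCoeff, zpow_sub_one_eq hq, zpow_sub_three_eq hq]
  generalize q ^ ((N : ℤ) - 2) = z at *
  have : 1 + z ≠ 0 := by positivity
  field_simp
  ring

/-- The sum is the total coefficient of `x_j η` in `η x_j`. -/
theorem bimod_coeff_sum (hN : 3 ≤ N) (hq : 0 < q) (hq1 : q ≠ 1) :
    q + (q ^ (N : ℤ) - q ^ ((N : ℤ) - 2)) / (1 - q ^ ((N : ℤ) - 1))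
      + (1 - q) * (1 + q ^ ((N : ℤ) - 2)) / (1 - q ^ ((N : ℤ) - 1)) = 1 := by
  have h1 := one_sub_zpow_ne_zero hN hq hq1
  rw [zpow_sub_one_eq hq, zpow_eq_mul_sq hq]
  generalize q ^ ((N : ℤ) - 2) = z at *
  have h1' : 1 - q * z ≠ 0 := by rwa [mul_comm]
  field_simp
  ring

/-- The condition under which the `K` component of `R̂⁻ + q I - formCoeff · K` is compatible with
the eigenvalue `q⁻¹`. The denominator is nonzero since `q^N ≠ 1`. -/
theorem formCoeff_spec (hN : 3 ≤ N) (hq : 0 < q) (hq1 : q ≠ 1) :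
    formCoeff N q * (q ^ ((N : ℤ) - 1) - q⁻¹) = (q - q⁻¹) * q ^ ((N : ℤ) - 1) := by
  refine div_mul_cancel₀ _ ?_
  have h1 := zpow_sub_one_ne_zero hN hq hq1
  rw [zpow_sub_one_eq hq]
  have : q ^ ((N : ℤ) - 2) * q - q⁻¹ = (q ^ ((N : ℤ) - 2) * q ^ 2 - 1) * q⁻¹ := by
    field_simp
  rw [this]
  exact mul_ne_zero h1 (inv_ne_zero hq.ne')

theorem one_add_ne_zero (hN : 3 ≤ N) (hq : 0 < q) (hq1 : q ≠ 1) {a : ℝ}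
    (ha : a = alphaPlus N q ∨ a = alphaMinus N q) : 1 + a ≠ 0 := by
  have h1 := one_sub_zpow_ne_zero hN hq hq1
  have hz := zpow_pos hq ((N : ℤ) - 2)
  have h2 : 1 + q ≠ 0 := by positivity
  rcases ha with rfl | rfl
  · rw [alphaPlus, zpow_sub_one_eq hq]
    generalize q ^ ((N : ℤ) - 2) = z at *
    have h1' : 1 - q * z ≠ 0 := by rwa [mul_comm]
    have : 1 + -(1 + z) / (1 - z * q) = -(z * (1 + q)) / (1 - z * q) := by field_simp; ring
    rw [this]
    exact div_ne_zero (neg_ne_zero.2 (mul_ne_zero hz.ne' h2)) h1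
  · rw [alphaMinus, zpow_sub_one_eq hq]
    generalize q ^ ((N : ℤ) - 2) = z at *
    have h1' : 1 - q * z ≠ 0 := by rwa [mul_comm]
    have : 1 + q * (1 + z) / (1 - z * q) = (1 + q) / (1 - z * q) := by field_simp; ring
    rw [this]
    exact div_ne_zero h2 h1

/-- The factor of `G` left after eliminating `P` and `η²`. The special values of `a` make it factor
completely. -/
theorem deta_coeff_ne_zero (hN : 3 ≤ N) (hq : 0 < q) (hq1 : q ≠ 1) {a : ℝ}
    (ha : a = alphaPlus N q ∨ a = alphaMinus N q) :
    ((1 + a) ^ 2 + a * (1 + a) * etaCoeff N q) * (q + q⁻¹)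
      + a * (1 - a * etaCoeff N q - (1 + a)) * (formCoeff N q - sphereCoeff N q) ≠ 0 := by
  have h1 := one_sub_zpow_ne_zero hN hq hq1
  have h3 := zpow_sub_one_ne_zero hN hq hq1
  have hz := zpow_pos hq ((N : ℤ) - 2)
  have h2 : 1 + q ≠ 0 := by positivity
  have h4 : q + q⁻¹ ≠ 0 := by positivity
  rw [etaCoeff, formCoeff, sphereCoeff, zpow_sub_one_eq hq, zpow_sub_three_eq hq]
  rcases ha with rfl | rfl
  · rw [alphaPlus, zpow_sub_one_eq hq]
    generalize q ^ ((N : ℤ) - 2) = z at *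
    have h1' : 1 - q * z ≠ 0 := by rwa [mul_comm]
    have h5 : 1 + z ≠ 0 := by positivity
    have h3' : q ^ 2 * z - 1 ≠ 0 := by rwa [mul_comm]
    have h6 : z * q - q⁻¹ = (z * q ^ 2 - 1) / q := by field_simp
    rw [h6]
    -- Closed form of the factor with `z = q^{N-2}`; its numerator is a nonzero multiple of a
    -- product of positive numbers.
    refine ne_of_eq_of_ne (b := -2 * (q + q⁻¹) * z ^ 2 * q ^ 2 * (1 + q) /
      ((z * q ^ 2 - 1) * (1 - z * q))) ?_ ?_
    · field_simp
      ring
    · exact div_ne_zero (by positivity) (mul_ne_zero h3 h1)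
  · rw [alphaMinus, zpow_sub_one_eq hq]
    generalize q ^ ((N : ℤ) - 2) = z at *
    have h1' : 1 - q * z ≠ 0 := by rwa [mul_comm]
    have h5 : 1 + z ≠ 0 := by positivity
    have h3' : q ^ 2 * z - 1 ≠ 0 := by rwa [mul_comm]
    have h6 : z * q - q⁻¹ = (z * q ^ 2 - 1) / q := by field_simp
    rw [h6]
    refine ne_of_eq_of_ne (b := -2 * (q + q⁻¹) * (1 + q) /
      ((z * q ^ 2 - 1) * (1 - z * q))) ?_ ?_
    · field_simp
      ring
    · exact div_ne_zero (by positivity) (mul_ne_zero h3 h1)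

end Constants

/-! ### Relations among functions and one-forms, and vanishing of `C^{kl} γ_k γ_l`. -/

/-- The relations between the generators `x_i` and the one-forms `y_i = dx_i` in an algebra in which
`C^{kl} dx_k dx_l = 0` and in which the forms `y_i + a x_i η` satisfy the quadratic relations given by
the left eigenvectors of `R̂⁻` with eigenvalue `q⁻¹`. -/
structure SphereForms (N : ℕ) (q a : ℝ) {Ω : Type*} [Ring Ω] [Algebra ℝ Ω]
    (x y : Fin N → Ω) (η : Ω) : Prop where
  eta_eq : η = ∑ k, wt N q k • (x k * y k.rev)
  radius : ∑ k, wt N q k • (x k * x k.rev) = 1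
  comm (i j : Fin N) : ∑ k, ∑ l, rMatInv N q k l i j • (x k * x l) =
    q⁻¹ • (x i * x j) + (sphereCoeff N q * metric N q i j) • (1 : Ω)
  bimod (i j : Fin N) : y i * x j = ∑ k, ∑ l, rMatInv N q k l i j • (x k * y l)
    + (q - 1) • (x i * y j)
    + ((q ^ (N : ℤ) - q ^ ((N : ℤ) - 2)) / (1 - q ^ ((N : ℤ) - 1)) * metric N q i j) • η
    + ((1 - q) * (1 + q ^ ((N : ℤ) - 2)) / (1 - q ^ ((N : ℤ) - 1))) • (x i * x j * η)
  leibniz : ∑ k, wt N q k • (y k * x k.rev) = -η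
  antisym (c : Fin N → Fin N → ℝ)
    (hc : ∀ k l, ∑ i, ∑ j, c i j * (q * rMatInv N q k l i j) = c k l) :
    ∑ i, ∑ j, c i j • ((y i + a • (x i * η)) * (y j + a • (x j * η))) = 0
  deta : ∑ k, wt N q k • (y k * y k.rev) = 0

section Pairing
variable {N : ℕ} {q : ℝ}

theorem sum_rev {M : Type*} [AddCommMonoid M] (f : Fin N → M) : ∑ k : Fin N, f k.rev = ∑ k, f k :=
  Fintype.sum_equiv Fin.revPerm _ _ fun _ => rfl

theorem sum_rMat_smul {V : Type*} [AddCommGroup V] [Module ℝ V] (v : Fin N → Fin N → V)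
    (i j : Fin N) : ∑ k, ∑ l, rMat N q k l i j • v k l =
      ∑ k, ∑ l, rMatInv N q k l i j • v k l + (q - q⁻¹) • v i j
        - ((q - q⁻¹) * metric N q i j) • ∑ k, wt N q k • v k k.rev := by
  rw [← sum_metric_smul v, Finset.smul_sum]
  have hI : v i j = ∑ k, ∑ l, (if k = i ∧ l = j then (1 : ℝ) else 0) • v k l := by
    simp [ite_and, Finset.sum_ite_eq']
  rw [hI, Finset.smul_sum, ← Finset.sum_add_distrib, ← Finset.sum_sub_distrib]
  refine Finset.sum_congr rfl fun k _ => ?_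
  rw [Finset.smul_sum, Finset.smul_sum, ← Finset.sum_add_distrib, ← Finset.sum_sub_distrib]
  refine Finset.sum_congr rfl fun l _ => ?_
  rw [smul_smul, smul_smul, ← add_smul, ← sub_smul, rMatInv, kMat]
  congr 1
  ring

theorem sum_wt_mul_metric (hq : 0 < q) {V : Type*} [AddCommGroup V] [Module ℝ V]
    (v : Fin N → V) (j : Fin N) : ∑ k, (wt N q k * metric N q k.rev j) • v k = v j := by
  simp only [metric_eq, Fin.rev_rev, mul_ite, mul_zero, wt_mul_rev hq, ite_smul, one_smul,
    zero_smul, Finset.sum_ite_eq, Finset.mem_univ, if_true]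

end Pairing

namespace SphereForms
variable {N : ℕ} {q a : ℝ} {Ω : Type*} [Ring Ω] [Algebra ℝ Ω] {x y : Fin N → Ω} {η : Ω}

/-- Contract the bimodule relation with `C^{ik} x_i` on the left. By the crossing relation the `R̂⁻`
term becomes `R̂` acting on `xx`, which the sphere relations evaluate as in `hR`; the other terms
simplify by the radius relation or by inverting the metric. -/
theorem eta_mul (h : SphereForms N q a x y η) (hN : 3 ≤ N) (hq : 0 < q) (hq1 : q ≠ 1) (j : Fin N) :
    η * x j = etaCoeff N q • y j + x j * η := by
  have hR (t : Fin N) : ∑ k, ∑ s, rMat N q k s j t • (x k * x s) =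
      q • (x j * x t) + ((sphereCoeff N q - q + q⁻¹) * metric N q j t) • (1 : Ω) := by
    rw [sum_rMat_smul, h.comm, h.radius]
    module
  have e1 : ∑ k, wt N q k • (x k * ∑ s, ∑ t, rMatInv N q s t k.rev j • (x s * y t)) =
      q • (x j * η) + (sphereCoeff N q - q + q⁻¹) • y j := by
    have : ∑ k, wt N q k • (x k * ∑ s, ∑ t, rMatInv N q s t k.rev j • (x s * y t)) =
        ∑ t, wt N q t.rev • ((∑ k, ∑ s, rMat N q k s j t.rev • (x k * x s)) * y t) := by
      simp only [Finset.mul_sum, Finset.sum_mul, Finset.smul_sum, mul_smul_comm, smul_mul_assoc,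
        smul_smul, wt_mul_rMatInv hq, mul_assoc]
      rw [Finset.sum_comm]
      conv_rhs => rw [Finset.sum_comm]; enter [2, k]; rw [Finset.sum_comm]
      rw [Finset.sum_comm]
      simp only [mul_comm]
    rw [this]
    simp only [hR, add_mul, smul_add, Finset.sum_add_distrib, smul_mul_assoc, one_mul, smul_smul]
    congr 1
    · rw [h.eta_eq, ← sum_rev fun k => wt N q k • (x k * y k.rev), Finset.mul_sum, Finset.smul_sum]
      simp only [Fin.rev_rev, mul_smul_comm, smul_smul, mul_assoc, mul_comm q]
    · have := sum_wt_mul_metric (N := N) hq (fun t => (sphereCoeff N q - q + q⁻¹) • y t) j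
      rw [← this]
      refine Finset.sum_congr rfl fun t _ => ?_
      rw [smul_smul]
      congr 1
      have : wt N q t.rev * metric N q j t.rev = wt N q t * metric N q t.rev j := by
        rw [metric_eq, metric_eq]
        simp only [Fin.rev_inj, Fin.rev_rev]
        by_cases ht : t = j
        · subst ht; simp [mul_comm]
        · simp [ht, Ne.symm ht]
      linear_combination (sphereCoeff N q - q + q⁻¹) * this
  have e2 : η * x j = ∑ k, wt N q k • (x k * (y k.rev * x j)) := by
    conv_lhs => rw [h.eta_eq]
    rw [Finset.sum_mul]
    simp only [smul_mul_assoc, mul_assoc]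
  set ν := (q ^ (N : ℤ) - q ^ ((N : ℤ) - 2)) / (1 - q ^ ((N : ℤ) - 1)) with hν
  set μ := (1 - q) * (1 + q ^ ((N : ℤ) - 2)) / (1 - q ^ ((N : ℤ) - 1)) with hμ
  have hs : q + ν + μ = 1 := bimod_coeff_sum hN hq hq1
  have hb := fun i => h.bimod i j
  simp only [← hν, ← hμ] at hb
  clear_value ν μ
  have e3 : ∑ k, wt N q k • (x k * ((q - 1) • (x k.rev * y j))) = (q - 1) • y j := by
    conv_rhs => rw [← one_mul (y j), ← h.radius, Finset.sum_mul, Finset.smul_sum]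
    simp only [smul_mul_assoc, mul_smul_comm, smul_smul, mul_comm (q - 1), mul_assoc]
  have e4 : ∑ k, wt N q k • (x k * ((ν * metric N q k.rev j) • η)) = ν • (x j * η) := by
    rw [← sum_wt_mul_metric hq (fun k => ν • (x k * η)) j]
    refine Finset.sum_congr rfl fun k _ => ?_
    rw [mul_smul_comm, smul_smul, smul_smul]
    congr 1; ring
  have e5 : ∑ k, wt N q k • (x k * (μ • (x k.rev * x j * η))) = μ • (x j * η) := by
    conv_rhs => rw [← one_mul (x j * η), ← h.radius, Finset.sum_mul, Finset.smul_sum]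
    simp only [smul_mul_assoc, mul_smul_comm, smul_smul, mul_comm μ, mul_assoc]
  rw [e2]
  simp only [hb, mul_add, smul_add, Finset.sum_add_distrib]
  rw [e1, e3, e4, e5, ← etaCoeff_eq hq]
  linear_combination (norm := module) hs • (x j * η)

/-- The forms `γ_i` satisfy `C^{kl} x_k γ_l = (1 + a) η`. -/
theorem sum_x_mul_gam (h : SphereForms N q a x y η) :
    ∑ k, wt N q k • (x k * (y k.rev + a • (x k.rev * η))) = (1 + a) • η := by
  have : ∑ k, wt N q k • (x k * (a • (x k.rev * η))) = a • η := by
    conv_rhs => rw [← one_mul η, ← h.radius, Finset.sum_mul, Finset.smul_sum]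
    simp only [smul_mul_assoc, mul_smul_comm, smul_smul, mul_comm a, mul_assoc]
  simp only [mul_add, smul_add, Finset.sum_add_distrib]
  rw [this, ← h.eta_eq]
  module

/-- Each row of `R̂⁻ + q I - formCoeff · K` is a left eigenvector of `R̂⁻` with eigenvalue `q⁻¹`:
the factor `R̂⁻ + q` kills the eigenvalue `-q`, and the `K` term removes the component along the
metric. -/
theorem rMatInv_gam (h : SphereForms N q a x y η) (hN : 3 ≤ N) (hq : 0 < q) (hq1 : q ≠ 1)
    {g : Fin N → Ω} (hg : ∀ i, g i = y i + a • (x i * η)) (i j : Fin N) :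
    ∑ k, ∑ l, rMatInv N q k l i j • (g k * g l) = (-q) • (g i * g j)
      + (formCoeff N q * metric N q i j) • ∑ k, wt N q k • (g k * g k.rev) := by
  have hI : g i * g j = ∑ k, ∑ l, (if k = i then if l = j then (1 : ℝ) else 0 else 0) •
      (g k * g l) := by
    simp [Finset.sum_ite_eq']
  have key := h.antisym (fun k l => rMatInv N q k l i j
    + q * (if k = i then if l = j then 1 else 0 else 0) - formCoeff N q * kMat N q k l i j) ?_
  · simp only [← hg, sub_smul, add_smul, Finset.sum_add_distrib, Finset.sum_sub_distrib] at key
    have e1 : ∑ k, ∑ l, (q * (if k = i then if l = j then (1 : ℝ) else 0 else 0)) • (g k * g l) =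
        q • (g i * g j) := by
      rw [hI]; simp only [Finset.smul_sum, smul_smul]
    have e2 : ∑ k, ∑ l, (formCoeff N q * kMat N q k l i j) • (g k * g l) =
        (formCoeff N q * metric N q i j) • ∑ k, wt N q k • (g k * g k.rev) := by
      rw [← sum_metric_smul fun k l => g k * g l]
      simp only [Finset.smul_sum, smul_smul, kMat, mul_assoc]
    rw [e1, e2] at key
    linear_combination (norm := module) key
  · intro k l
    have hc := formCoeff_spec hN hq hq1
    have h1 := rMatInv_sq hq i j k l
    have h2 := sum_metric_mul_rMatInv hq k l
    have h3 : ∑ a, ∑ b, (if a = i then if b = j then (1 : ℝ) else 0 else 0) *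
        rMatInv N q k l a b = rMatInv N q k l i j := by
      simp [Finset.sum_ite_eq']
    have h4 : ∑ a, ∑ b, kMat N q a b i j * rMatInv N q k l a b =
        q ^ ((N : ℤ) - 1) * kMat N q k l i j := by
      have := congrArg (metric N q i j * ·) h2
      simp only [Finset.mul_sum] at this
      simp only [kMat, mul_assoc, this]
      ring
    have e : ∀ a b, (rMatInv N q a b i j + q * (if a = i then if b = j then 1 else 0 else 0)
        - formCoeff N q * kMat N q a b i j) * (q * rMatInv N q k l a b) =
        q * (rMatInv N q a b i j * rMatInv N q k l a b)
        + q ^ 2 * ((if a = i then if b = j then 1 else 0 else 0) * rMatInv N q k l a b)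
        - formCoeff N q * q * (kMat N q a b i j * rMatInv N q k l a b) := by
      intros; ring
    simp only [e, Finset.sum_add_distrib, Finset.sum_sub_distrib, ← Finset.mul_sum, h1, h3, h4]
    have hqq : q * q⁻¹ = 1 := mul_inv_cancel₀ hq.ne'
    linear_combination (-q * kMat N q k l i j) * hc
      + (rMatInv N q k l i j - formCoeff N q * kMat N q k l i j) * hqq

/-- The nested contraction of `x_s x_k` with `γ_l γ_t`. -/
theorem nested_contraction (h : SphereForms N q a x y η) (hN : 3 ≤ N) (hq : 0 < q) (hq1 : q ≠ 1)
    {g : Fin N → Ω} (hg : ∀ i, g i = y i + a • (x i * η)) :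
    (q + q⁻¹) • ∑ s, ∑ k, (wt N q k * wt N q s) • (x s * x k * (g k.rev * g s.rev)) =
      (formCoeff N q - sphereCoeff N q) • ∑ k, wt N q k • (g k * g k.rev) := by
  set G := ∑ k, wt N q k • (g k * g k.rev) with hG
  -- Evaluate the contraction with `R̂⁻` inserted in two ways. On `xx` it gives `q⁻¹` plus a metric
  -- term, on `γγ` it gives `-q` plus a multiple of `G`; the comparison produces the factor `q +
  -- q⁻¹`.
  have hL : ∑ s, ∑ k, (wt N q k * wt N q s) •
      ((∑ u, ∑ v, rMatInv N q u v s k • (x u * x v)) * (g k.rev * g s.rev)) =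
      ∑ u, ∑ v, (wt N q v * wt N q u) •
      (x u * x v * ∑ k, ∑ s, rMatInv N q k s v.rev u.rev • (g k * g s)) := by
    have : ∀ u v : Fin N, ∑ k, ∑ s, rMatInv N q k s v.rev u.rev • (g k * g s) =
        ∑ s : Fin N, ∑ k : Fin N, rMatInv N q k.rev s.rev v.rev u.rev • (g k.rev * g s.rev) := by
      intro u v
      rw [Finset.sum_comm, ← sum_rev]
      refine Finset.sum_congr rfl fun s _ => ?_
      rw [← sum_rev]
    simp only [this]
    simp only [Finset.mul_sum, Finset.sum_mul, Finset.smul_sum, mul_smul_comm, smul_mul_assoc,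
        smul_smul, wt_mul_wt_mul_rMatInv hq]
    simp only [mul_comm (rMatInv N q _ _ _ _)]
    rw [Finset.sum_comm]
    conv_lhs => enter [2, k]; rw [Finset.sum_comm]
    rw [Finset.sum_comm]
    refine Finset.sum_congr rfl fun u _ => ?_
    conv_lhs => enter [2, k]; rw [Finset.sum_comm]
    rw [Finset.sum_comm]
    refine Finset.sum_congr rfl fun v _ => ?_
    rw [Finset.sum_comm]
  have hx : ∑ s, ∑ k, (wt N q k * wt N q s) •
      ((sphereCoeff N q * metric N q s k) • (1 : Ω) * (g k.rev * g s.rev)) =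
      sphereCoeff N q • G := by
    rw [hG, Finset.smul_sum]
    refine Finset.sum_congr rfl fun s _ => ?_
    simp only [metric_eq, mul_ite, mul_zero, ite_smul, zero_smul, ite_mul, zero_mul, smul_zero,
      Fin.rev_rev, smul_ite, Finset.sum_ite_eq', Finset.mem_univ, if_true, smul_mul_assoc, one_mul,
      smul_smul]
    congr 1
    linear_combination (sphereCoeff N q * wt N q s) * wt_mul_rev hq s
  have hy : ∑ u, ∑ v, (wt N q v * wt N q u) •
      (x u * x v * ((formCoeff N q * metric N q v.rev u.rev) • G)) = formCoeff N q • G := by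
    conv_rhs => rw [← one_mul G, ← h.radius, Finset.sum_mul, Finset.smul_sum]
    refine Finset.sum_congr rfl fun u _ => ?_
    rw [Finset.sum_eq_single u.rev]
    · rw [metric_eq, if_pos (Fin.rev_rev _).symm, mul_smul_comm, smul_smul, smul_mul_assoc, smul_smul]
      rw [Fin.rev_rev]
      congr 1
      linear_combination (formCoeff N q * wt N q u) * wt_mul_rev hq u
    · intro v _ hv
      rw [metric_eq, Fin.rev_rev, if_neg (fun h => hv h.symm)]
      simp
    · simp
  simp only [h.comm, h.rMatInv_gam hN hq hq1 hg, add_mul, mul_add, smul_add,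
    Finset.sum_add_distrib, hx] at hL
  rw [← hG, hy] at hL
  simp only [smul_mul_assoc, mul_smul_comm, smul_comm _ q⁻¹, smul_comm _ (-q),
    ← Finset.smul_sum] at hL
  linear_combination (norm := module) hL

/-- The contraction `C^{kl} γ_k γ_l` vanishes. -/
theorem sum_gam_mul_gam (h : SphereForms N q a x y η) (hN : 3 ≤ N) (hq : 0 < q) (hq1 : q ≠ 1)
    (ha : a = alphaPlus N q ∨ a = alphaMinus N q)
    {g : Fin N → Ω} (hg : ∀ i, g i = y i + a • (x i * η)) :
    ∑ k, wt N q k • (g k * g k.rev) = 0 := by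
  set A := etaCoeff N q with hA
  set G := ∑ k, wt N q k • (g k * g k.rev) with hG
  set P := ∑ k, wt N q k • (x k * η * g k.rev) with hP
  have hΦ := h.nested_contraction hN hq hq1 hg
  have hη : ∑ k, wt N q k • (x k * g k.rev) = (1 + a) • η := by
    simp only [hg]; exact h.sum_x_mul_gam
  have hy : ∀ k, y k = g k - a • (x k * η) := fun k => by rw [hg]; abel
  have e2 : (1 + a) • P = ∑ s, ∑ k, (wt N q k * wt N q s) • (x s * x k * (g k.rev * g s.rev)) := by
    rw [hP, Finset.smul_sum]
    refine Finset.sum_congr rfl fun s _ => ?_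
    rw [smul_comm, ← smul_mul_assoc, ← mul_smul_comm (1 + a) (x s) η, ← hη, Finset.mul_sum, Finset.sum_mul,
      Finset.smul_sum]
    refine Finset.sum_congr rfl fun k _ => ?_
    rw [mul_smul_comm, smul_mul_assoc, smul_smul, mul_comm (wt N q s)]
    simp only [mul_assoc]
  have e3 : (1 + a) • (η * η) = A • G + (1 - a * A) • P := by
    rw [← mul_smul_comm, ← hη, Finset.mul_sum, hG, hP, Finset.smul_sum, Finset.smul_sum,
      ← Finset.sum_add_distrib]
    refine Finset.sum_congr rfl fun k _ => ?_
    rw [mul_smul_comm, ← mul_assoc, h.eta_mul hN hq hq1, hy]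
    simp only [add_mul, sub_mul, smul_mul_assoc, smul_sub, smul_add]
    module
  have e4 : G - a • P + a • (η * η) = 0 := by
    rw [← h.deta]
    -- In the part containing `x_{k'} η` the left factor stays `dx_k`, so that `C^{kl} dx_k x_l =
    -- -η` applies and yields `η²`.
    have : ∑ k, wt N q k • (y k * y k.rev) = G - a • P -
        a • ((∑ k, wt N q k • (y k * x k.rev)) * η) := by
      rw [hG, hP, Finset.sum_mul, Finset.smul_sum, Finset.smul_sum, ← Finset.sum_sub_distrib,
        ← Finset.sum_sub_distrib]
      refine Finset.sum_congr rfl fun k _ => ?_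
      conv_lhs => rw [hy k.rev, mul_sub, hy k, sub_mul, ← hy k]
      simp only [mul_smul_comm, smul_mul_assoc, mul_assoc]
      module
    rw [this, h.leibniz]
    simp
  rw [← e2] at hΦ
  -- `e3` eliminates `η²` from `e4`, and then `hΦ` eliminates `P`.
  have e5 : (((1 + a) ^ 2 + a * (1 + a) * A) * (q + q⁻¹)
      + a * (1 - a * A - (1 + a)) * (formCoeff N q - sphereCoeff N q)) • G = 0 := by
    linear_combination (norm := module) ((1 + a) ^ 2 * (q + q⁻¹)) • e4 - (a * (1 + a) * (q + q⁻¹)) • e3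
      - (a * (1 - a * A - (1 + a))) • hΦ
  exact (smul_eq_zero.1 e5).resolve_left (deta_coeff_ne_zero hN hq hq1 ha)

end SphereForms

/-! ### Reordering words -/

/-- The value of a word read as a number in base `N`; it orders words of equal length
lexicographically. -/
def wordRank {N : ℕ} : List (Fin N) → ℕ
  | [] => 0
  | i :: w => i * N ^ w.length + wordRank w

theorem wordRank_lt {N : ℕ} (w : List (Fin N)) : wordRank w < N ^ w.length := by
  induction w with
  | nil => simp [wordRank]
  | cons i w ih =>
    rw [wordRank, List.length_cons, pow_succ']
    have : ((i : ℕ) + 1) * N ^ w.length ≤ N * N ^ w.length := Nat.mul_le_mul_right _ i.isLt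
    linarith

/-- The digit `l` is arbitrary: a smaller digit in the earlier position outweighs everything after
it. -/
theorem wordRank_lt_wordRank {N : ℕ} (u v : List (Fin N)) {i j k l : Fin N} (h : k < i) :
    wordRank (u ++ k :: l :: v) < wordRank (u ++ i :: j :: v) := by
  induction u with
  | nil =>
    have h1 := wordRank_lt (l :: v)
    have h2 : ((k : ℕ) + 1) * N ^ (l :: v).length ≤ i * N ^ (l :: v).length :=
      Nat.mul_le_mul_right _ h
    change (k : ℕ) * N ^ (l :: v).length + wordRank (l :: v) <
      i * N ^ (l :: v).length + wordRank (j :: v)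
    linarith [Nat.zero_le (wordRank (j :: v))]
  | cons b u ih => simpa [wordRank] using ih

theorem exists_descent_of_not_isChain {α : Type*} [LinearOrder α] (w : List α)
    (h : ¬ w.IsChain (· < ·)) : ∃ u i j v, w = u ++ i :: j :: v ∧ j ≤ i := by
  induction w with
  | nil => simp at h
  | cons i w ih =>
    cases w with
    | nil => simp at h
    | cons j w =>
      by_cases hij : i < j
      · have : ¬ (j :: w).IsChain (· < ·) := fun h' => h (List.isChain_cons_cons.2 ⟨hij, h'⟩)
        obtain ⟨u, k, l, v, hw, hkl⟩ := ih this
        exact ⟨i :: u, k, l, v, by rw [hw]; rfl, hkl⟩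
      · exact ⟨[], i, j, w, rfl, not_lt.1 hij⟩

/-- If each descending product of two generators is a combination of lexicographically smaller
products, then every word is a combination of strictly increasing words. -/
theorem word_mem_span {R Ω : Type*} [CommRing R] [Ring Ω] [Algebra R Ω] {N : ℕ} (g : Fin N → Ω)
    (hg : ∀ i j, j ≤ i → g i * g j ∈ Submodule.span R {p | ∃ k l, k < i ∧ p = g k * g l})
    (w : List (Fin N)) : (w.map g).prod ∈ Submodule.span R
      {p | ∃ v : List (Fin N), v.length = w.length ∧ v.IsChain (· < ·) ∧ p = (v.map g).prod} := by
  induction hr : wordRank w using Nat.strong_induction_on generalizing w with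
  | _ r ih =>
    by_cases hw : w.IsChain (· < ·)
    · exact Submodule.subset_span ⟨w, rfl, hw, rfl⟩
    · obtain ⟨u, i, j, v, rfl, hij⟩ := exists_descent_of_not_isChain w hw
      -- Multiplication by the fixed words `u` and `v` on the two sides is linear, so the rewriting
      -- of the pair can be done inside the word.
      have hle : Submodule.span R {p | ∃ k l, k < i ∧ p = g k * g l} ≤ (Submodule.span R
          {p | ∃ z : List (Fin N), z.length = (u ++ i :: j :: v).length ∧ z.IsChain (· < ·) ∧
            p = (z.map g).prod}).comap
          (LinearMap.mulRight R (v.map g).prod ∘ₗ LinearMap.mulLeft R (u.map g).prod) := by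
        rw [Submodule.span_le]
        rintro _ ⟨k, l, hk, rfl⟩
        have := ih _ (hr ▸ wordRank_lt_wordRank u v (l := l) (j := j) hk) (u ++ k :: l :: v) rfl
        simpa [mul_assoc] using this
      have := hle (hg i j hij)
      simpa [mul_assoc] using this

/-! ### Rewriting descending products by `R̂⁻ γγ = -q γγ`. -/

section Quadratic
variable {N : ℕ} {q : ℝ} {Ω : Type*} [Ring Ω] [Algebra ℝ Ω] {g : Fin N → Ω}

/-- The relation at `(i, i')` also contains `γ_{l'} γ_l` for `l < i`, whose first index exceeds
`i'`, so these are reduced first, by induction on `i`. The bound `k ≤ i` is what survives the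
induction: `k ≤ l < i ≤ i'` gives `k < i'`, whereas `k < l'` would not. -/
theorem rev_mul_mem_span (hq : 0 < q)
    (hg : ∀ i j, ∑ k, ∑ l, rMatInv N q k l i j • (g k * g l) = (-q) • (g i * g j))
    (i : Fin N) (hi : i ≤ i.rev) :
    g i.rev * g i ∈ Submodule.span ℝ {p | ∃ k l, k ≤ i ∧ k < i.rev ∧ p = g k * g l} := by
  have hq0 := hq.ne'
  induction hn : (i : ℕ) using Nat.strong_induction_on generalizing i with
  | _ n ih =>
    have hS : ∑ l ∈ Finset.Iio i, wt N q l.rev • (g l.rev * g l) ∈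
        Submodule.span ℝ {p | ∃ k l, k ≤ i ∧ k < i.rev ∧ p = g k * g l} := by
      refine Submodule.sum_mem _ fun l hl => Submodule.smul_mem _ _ ?_
      rw [Finset.mem_Iio] at hl
      have hli : i.rev < l.rev := Fin.rev_lt_rev.2 hl
      refine Submodule.span_mono ?_ (ih l (hn ▸ hl) l (hl.le.trans (hi.trans hli.le)) rfl)
      rintro _ ⟨k, m, hk, -, rfl⟩
      exact ⟨k, m, hk.trans hl.le, (hk.trans_lt hl).trans_le hi, rfl⟩
    have h := hg i i.rev
    rw [sum_rMatInv_smul hq] at h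
    simp only [swapCoeff, Fin.rev_rev, if_true, if_neg hi.not_gt, smul_zero, sub_zero] at h
    by_cases hii : i = i.rev
    -- At the middle index both sides of the relation contain the square `γ_i γ_i`, which is
    -- isolated by dividing by `1 + q`.
    · rw [if_pos hii, ← hii, one_smul] at h
      have : g i * g i = (-((1 + q)⁻¹ * ((q - q⁻¹) * wt N q i))) •
          ∑ l ∈ Finset.Iio i, wt N q l.rev • (g l.rev * g l) := by
        have h1 : (1 + q) • (g i * g i) = (-((q - q⁻¹) * wt N q i)) •
            ∑ l ∈ Finset.Iio i, wt N q l.rev • (g l.rev * g l) := by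
          linear_combination (norm := module) h
        have h2 : (1 + q) ≠ 0 := by positivity
        rw [← inv_smul_smul₀ h2 (g i * g i), h1, smul_smul]
        congr 1
        ring
      rw [← hii] at hS ⊢
      rw [this]
      exact Submodule.smul_mem _ _ hS
    · rw [if_neg hii] at h
      have : g i.rev * g i = (-1 : ℝ) • (g i * g i.rev) + (-(q⁻¹ * ((q - q⁻¹) * wt N q i))) •
          ∑ l ∈ Finset.Iio i, wt N q l.rev • (g l.rev * g l) := by
        have h1 : q • (g i.rev * g i) = (-q) • (g i * g i.rev) + (-((q - q⁻¹) * wt N q i)) •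
            ∑ l ∈ Finset.Iio i, wt N q l.rev • (g l.rev * g l) := by
          linear_combination (norm := module) h
        rw [← inv_smul_smul₀ hq0 (g i.rev * g i), h1, smul_add, smul_smul, smul_smul]
        congr 2
        · field_simp
        · ring
      rw [this]
      refine Submodule.add_mem _ (Submodule.smul_mem _ _ (Submodule.subset_span ?_))
        (Submodule.smul_mem _ _ hS)
      exact ⟨i, i.rev, le_rfl, lt_of_le_of_ne hi hii, rfl⟩

theorem mul_mem_span_of_le (hq : 0 < q)
    (hg : ∀ i j, ∑ k, ∑ l, rMatInv N q k l i j • (g k * g l) = (-q) • (g i * g j))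
    (i j : Fin N) (hij : j ≤ i) :
    g i * g j ∈ Submodule.span ℝ {p | ∃ k l, k < i ∧ p = g k * g l} := by
  have hq0 := hq.ne'
  by_cases hr : i = j.rev
  · subst hr
    refine Submodule.span_mono ?_ (rev_mul_mem_span hq hg j hij)
    rintro _ ⟨k, l, -, hk, rfl⟩
    exact ⟨k, l, hk, rfl⟩
  -- With the indices in the order `(j, i)` the triangular term of `R̂⁻` drops out. The relation
  -- reads `γ_i γ_j = -q γ_j γ_i` for `j < i`, and gives `γ_j² = 0` for `i = j`.
  · have h := hg j i
    have hr' : j ≠ i.rev := by rintro rfl; simp at hr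
    rw [sum_rMatInv_smul hq] at h
    simp only [swapCoeff, if_neg hr, if_neg hr', if_neg hij.not_gt, smul_zero, sub_zero, mul_zero,
      zero_smul, add_zero] at h
    rcases hij.lt_or_eq with hlt | rfl
    · rw [if_neg hlt.ne, one_smul] at h
      rw [h]
      exact Submodule.smul_mem _ _ (Submodule.subset_span ⟨j, i, hlt, rfl⟩)
    · rw [if_pos rfl] at h
      have h1 : (q + q⁻¹) • (g j * g j) = 0 := by
        linear_combination (norm := module) h
      have h2 : q + q⁻¹ ≠ 0 := by positivity
      rw [(smul_eq_zero.1 h1).resolve_left h2]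
      exact Submodule.zero_mem _

end Quadratic

/-! ### Two-sided actions and left submodules of a bimodule. -/

section Bimodule
variable {A M : Type} [Ring A] [Algebra ℂ A] [AddCommGroup M] [Module (Env A) M]

theorem Env.tmul_mul_tmul (a b c d : A) : Env.tmul a b * Env.tmul c d = Env.tmul (a * c) (d * b) :=
  Algebra.TensorProduct.tmul_mul_tmul _ _ _ _

theorem Env.tmul_add_left (a b c : A) : Env.tmul (a + b) c = Env.tmul a c + Env.tmul b c :=
  TensorProduct.add_tmul _ _ _

theorem Env.tmul_add_right (a b c : A) : Env.tmul a (b + c) = Env.tmul a b + Env.tmul a c := by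
  unfold Env.tmul
  rw [MulOpposite.op_add]
  exact TensorProduct.tmul_add _ _ _

theorem Env.tmul_algebraMap (c : ℂ) : Env.tmul 1 (algebraMap ℂ A c) = Env.tmul (algebraMap ℂ A c) 1 := by
  unfold Env.tmul
  rw [Algebra.algebraMap_eq_smul_one, MulOpposite.op_smul]
  exact (TensorProduct.smul_tmul c (1 : A) (1 : Aᵐᵒᵖ)).symm

theorem lact_lact (a b : A) (m : M) : lact a (lact b m) = lact (a * b) m := by
  rw [lact, lact, lact, smul_smul, Env.tmul_mul_tmul, one_mul]

theorem ract_ract (a b : A) (m : M) : ract (ract m a) b = ract m (a * b) := by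
  rw [ract, ract, ract, smul_smul, Env.tmul_mul_tmul, one_mul]

theorem lact_ract (a b : A) (m : M) : lact a (ract m b) = ract (lact a m) b := by
  rw [lact, ract, lact, ract, smul_smul, smul_smul, Env.tmul_mul_tmul, Env.tmul_mul_tmul]
  simp

theorem lact_add (a : A) (m n : M) : lact a (m + n) = lact a m + lact a n := smul_add _ _ _

theorem ract_add (a : A) (m n : M) : ract (m + n) a = ract m a + ract n a := smul_add _ _ _

theorem lact_zero (a : A) : lact a (0 : M) = 0 := smul_zero _

theorem ract_zero (a : A) : ract (0 : M) a = 0 := smul_zero _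

theorem lact_neg (a : A) (m : M) : lact a (-m) = -lact a m := smul_neg _ _

theorem ract_neg (a : A) (m : M) : ract (-m) a = -ract m a := smul_neg _ _

theorem one_lact (m : M) : lact (1 : A) m = m := one_smul (Env A) m

theorem one_ract (m : M) : ract m (1 : A) = m := one_smul (Env A) m

theorem neg_one_lact (m : M) : lact (-1 : A) m = -m := by
  have : Env.tmul (-1 : A) 1 = -(1 : Env A) := TensorProduct.neg_tmul _ _
  rw [lact, this, neg_smul, one_smul]

theorem add_ract (a b : A) (m : M) : ract m (a + b) = ract m a + ract m b := by
  rw [ract, Env.tmul_add_right, add_smul]; rfl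

theorem ract_algebraMap (c : ℂ) (m : M) : ract m (algebraMap ℂ A c) = lact (algebraMap ℂ A c) m := by
  rw [ract, Env.tmul_algebraMap]; rfl

/-- The left submodule generated by a family, as an additive subgroup. -/
def leftSpan {ι : Type} (g : ι → M) : AddSubgroup M :=
  AddSubgroup.closure {m | ∃ (a : A) (i : ι), m = lact a (g i)}

variable {ι : Type} {g : ι → M}

theorem lact_mem_leftSpan (a : A) (i : ι) : lact a (g i) ∈ leftSpan (A := A) g :=
  AddSubgroup.subset_closure ⟨a, i, rfl⟩

theorem self_mem_leftSpan (i : ι) : g i ∈ leftSpan (A := A) g := by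
  have := lact_mem_leftSpan (g := g) (1 : A) i
  rwa [one_lact] at this

theorem leftSpan_lact (a : A) {m : M} (hm : m ∈ leftSpan (A := A) g) :
    lact a m ∈ leftSpan (A := A) g := by
  induction hm using AddSubgroup.closure_induction with
  | mem m h => obtain ⟨b, i, rfl⟩ := h; rw [lact_lact]; exact lact_mem_leftSpan _ _
  | zero => rw [lact_zero]; exact zero_mem _
  | add m n _ _ h1 h2 => rw [lact_add]; exact add_mem h1 h2
  | neg m _ h => rw [lact_neg]; exact neg_mem h

theorem leftSpan_ract (b : A) (h : ∀ i, ract (g i) b ∈ leftSpan (A := A) g) {m : M}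
    (hm : m ∈ leftSpan (A := A) g) : ract m b ∈ leftSpan (A := A) g := by
  induction hm using AddSubgroup.closure_induction with
  | mem m h' => obtain ⟨a, i, rfl⟩ := h'; rw [← lact_ract]; exact leftSpan_lact _ (h i)
  | zero => rw [ract_zero]; exact zero_mem _
  | add m n _ _ h1 h2 => rw [ract_add]; exact add_mem h1 h2
  | neg m _ h => rw [ract_neg]; exact neg_mem h

end Bimodule

/-! ### The differentials `dx_i` as left generators of `Γ`. -/

section Calculus
variable (N : ℕ) (q : ℝ)

theorem Sphere.induction {N : ℕ} {q : ℝ} {p : Sphere N q → Prop}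
    (algebraMap : ∀ c : ℂ, p (algebraMap ℂ _ c)) (x : ∀ i, p (Sphere.x N q i))
    (mul : ∀ a b, p a → p b → p (a * b)) (add : ∀ a b, p a → p b → p (a + b)) (a : Sphere N q) :
    p a := by
  obtain ⟨b, rfl⟩ := RingQuot.mkAlgHom_surjective ℂ (SphereRel N q) a
  induction b using FreeAlgebra.induction with
  | grade0 c =>
    exact (congrArg p (AlgHom.commutes (RingQuot.mkAlgHom ℂ (SphereRel N q)) c)).mpr (algebraMap c)
  | grade1 i => exact x i
  | mul b c hb hc => rw [map_mul]; exact mul _ _ hb hc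
  | add b c hb hc => rw [map_add]; exact add _ _ hb hc

theorem d_add (x y : Sphere N q) : d N q (x + y) = d N q x + d N q y :=
  (Submodule.Quotient.eq _).2 (Submodule.subset_span (FormRel.add x y))

theorem d_smul (c : ℂ) (x : Sphere N q) : d N q (c • x) = lact (algebraMap ℂ (Sphere N q) c) (d N q x) :=
  (Submodule.Quotient.eq _).2 (Submodule.subset_span (FormRel.smul c x))

theorem d_one : d N q 1 = 0 := by
  have h := d_mul N q 1 1
  rw [one_ract, one_lact, mul_one] at h
  simpa using h

theorem d_algebraMap (c : ℂ) : d N q (algebraMap ℂ _ c) = 0 := by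
  rw [Algebra.algebraMap_eq_smul_one, d_smul, d_one, lact_zero]

open Sphere in
theorem ract_d_x (i j : Fin N) : ract (d N q (x N q i)) (x N q j) =
    (∑ k, ∑ l, lact ((rMatInv N q k l i j : ℂ) • x N q k) (d N q (x N q l)))
        + lact (((q - 1 : ℝ) : ℂ) • x N q i) (d N q (x N q j))
        + (∑ k, ∑ l,
            lact ((((q ^ (N : ℤ) - q ^ ((N : ℤ) - 2)) / (1 - q ^ ((N : ℤ) - 1))
              * kMat N q k l i j : ℝ) : ℂ) • x N q k) (d N q (x N q l)))
        + (∑ k, ∑ l,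
            lact ((((1 - q) * (1 + q ^ ((N : ℤ) - 2)) / (1 - q ^ ((N : ℤ) - 1))
              * metric N q k l : ℝ) : ℂ) • (x N q i * x N q j * x N q k))
              (d N q (x N q l))) := by
  have h := (Submodule.Quotient.eq (Submodule.span (Env (Sphere N q)) {r | FormRel N q r})).2
    (Submodule.subset_span (FormRel.bimod (N := N) (q := q) i j))
  have hmk : ∀ a : FreeForms N q, Submodule.Quotient.mk (p := Submodule.span (Env (Sphere N q))
    {r | FormRel N q r}) a = Submodule.mkQ (Submodule.span (Env (Sphere N q))
    {r | FormRel N q r}) a := fun _ => rfl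
  rw [hmk, hmk] at h
  simp only [map_add, map_sum, lact, ract, map_smul] at h
  exact h

/-- The bimodule relations make the left span of the `dx_i` stable under right multiplication by
each `x_j`, hence by all functions. The Leibniz rule then puts every differential into it, and these
generate the bimodule. -/
theorem leftSpan_d_x (θ : OneForms N q) :
    θ ∈ leftSpan (A := Sphere N q) fun i => d N q (Sphere.x N q i) := by
  set g := fun i => d N q (Sphere.x N q i) with hg
  have hr : ∀ (b : Sphere N q) (m : OneForms N q), m ∈ leftSpan (A := Sphere N q) g →
      ract m b ∈ leftSpan (A := Sphere N q) g := by
    intro b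
    induction b using Sphere.induction with
    | algebraMap c => intro m hm; rw [ract_algebraMap]; exact leftSpan_lact _ hm
    | x j =>
      intro m hm
      refine leftSpan_ract _ (fun i => ?_) hm
      rw [hg, ract_d_x]
      have hl : ∀ a k, lact a (d N q (Sphere.x N q k)) ∈ leftSpan (A := Sphere N q) g :=
        fun a k => lact_mem_leftSpan (g := g) a k
      exact add_mem (add_mem (add_mem (sum_mem fun k _ => sum_mem fun l _ => hl _ _) (hl _ _))
        (sum_mem fun k _ => sum_mem fun l _ => hl _ _)) (sum_mem fun k _ => sum_mem fun l _ => hl _ _)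
    | mul a b ha hb => intro m hm; rw [← ract_ract]; exact hb _ (ha _ hm)
    | add a b ha hb => intro m hm; rw [add_ract]; exact add_mem (ha _ hm) (hb _ hm)
  have hd : ∀ a, d N q a ∈ leftSpan (A := Sphere N q) g := by
    intro a
    induction a using Sphere.induction with
    | algebraMap c => rw [d_algebraMap]; exact zero_mem _
    | x j => exact self_mem_leftSpan (g := g) j
    | mul a b ha hb => rw [d_mul]; exact add_mem (hr _ _ ha) (leftSpan_lact _ hb)
    | add a b ha hb => rw [d_add]; exact add_mem ha hb
  obtain ⟨f, rfl⟩ := Submodule.mkQ_surjective (Submodule.span (Env (Sphere N q))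
    {r | FormRel N q r}) θ
  induction f using Finsupp.induction_linear with
  | zero => rw [map_zero]; exact zero_mem _
  | add f g hf hg => rw [map_add]; exact add_mem hf hg
  | single a e =>
    have : Submodule.mkQ (Submodule.span (Env (Sphere N q)) {r | FormRel N q r})
        (Finsupp.single a e) = e • d N q a := by
      rw [show Finsupp.single a e = e • symb N q a by simp [symb], map_smul]; rfl
    rw [this]
    clear this
    induction e using TensorProduct.induction_on with
    | zero => exact (zero_smul (Env (Sphere N q)) (d N q a)).symm ▸ zero_mem _
    | tmul b c =>
      have : Env.tmul b c.unop • d N q a = lact b (ract (d N q a) c.unop) := by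
        rw [lact, ract, smul_smul, Env.tmul_mul_tmul, mul_one, mul_one]
      exact this ▸ leftSpan_lact _ (hr _ _ (hd a))
    | add e f he hf => exact (add_smul (R := Env (Sphere N q)) e f (d N q a)).symm ▸ add_mem he hf

end Calculus

theorem x_comm (N : ℕ) (q : ℝ) (i j : Fin N) :
    ∑ k, ∑ l, (rMatInv N q k l i j : ℂ) • (Sphere.x N q k * Sphere.x N q l) =
      ((q⁻¹ : ℝ) : ℂ) • (Sphere.x N q i * Sphere.x N q j)
        + (sphereCoeff N q : ℂ) •
          ∑ k, ∑ l, (kMat N q k l i j : ℂ) • (Sphere.x N q k * Sphere.x N q l) := by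
  have h := RingQuot.mkAlgHom_rel ℂ (SphereRel.comm (N := N) (q := q) i j)
  simp only [map_sum, map_add, map_smul, map_mul] at h
  exact h

theorem x_radius (N : ℕ) (q : ℝ) :
    ∑ k, ∑ l, (metric N q k l : ℂ) • (Sphere.x N q k * Sphere.x N q l) = 1 := by
  have h := RingQuot.mkAlgHom_rel ℂ (SphereRel.radius (N := N) (q := q))
  simp only [map_sum, map_smul, map_mul, map_one] at h
  exact h

/-! ### Transfer of the abstract relations to an algebra receiving `X` and `Γ`. -/

section Realization
variable {N : ℕ} {q a : ℝ} {Ω : Type*} [Ring Ω] [Algebra ℂ Ω]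
  (F : Sphere N q →+* Ω) (f : OneForms N q →+ Ω)

theorem sphereForms_of_map (hF : ∀ (c : ℂ) b, F (c • b) = c • F b)
    (hl : ∀ b θ, f (lact b θ) = F b * f θ) (hr : ∀ θ b, f (ract θ b) = f θ * F b)
    (hker : ∀ c : Fin N → Fin N → ℝ,
      (∀ k l, ∑ i, ∑ j, c i j * (q * rMatInv N q k l i j) = c k l) →
      ∑ i, ∑ j, (c i j : ℂ) • (f (gam N q a i) * f (gam N q a j)) = 0)
    (hdeta : ∑ k, ∑ l, (metric N q k l : ℂ) •
      (f (d N q (Sphere.x N q k)) * f (d N q (Sphere.x N q l))) = 0) :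
    SphereForms N q a (fun i => F (Sphere.x N q i)) (fun i => f (d N q (Sphere.x N q i)))
      (f (eta N q)) := by
  have hFr : ∀ (c : ℝ) b, F (c • b) = c • F b := fun c b => by
    rw [← Complex.coe_smul, hF, Complex.coe_smul]
  have hη : f (eta N q) = ∑ k, ∑ l, metric N q k l •
      (F (Sphere.x N q k) * f (d N q (Sphere.x N q l))) := by
    simp only [eta, map_sum, hl, hFr, smul_mul_assoc, Complex.coe_smul]
  have hx : ∑ k, ∑ l, metric N q k l • (F (Sphere.x N q k) * F (Sphere.x N q l)) = 1 := by
    rw [← map_one F, ← x_radius N q]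
    simp only [map_sum, hFr, map_mul, Complex.coe_smul]
  have hK : ∀ i j (v : Fin N → Fin N → Ω), ∑ k, ∑ l, kMat N q k l i j • v k l =
      metric N q i j • ∑ k, ∑ l, metric N q k l • v k l := by
    intro i j v
    simp only [kMat, Finset.smul_sum, smul_smul]
  refine ⟨?_, ?_, ?_, ?_, ?_, ?_, ?_⟩
  · rw [hη, sum_metric_smul fun k l => F (Sphere.x N q k) * f (d N q (Sphere.x N q l))]
  · rw [← hx, sum_metric_smul fun k l => F (Sphere.x N q k) * F (Sphere.x N q l)]
  · intro i j
    have h := congrArg F (x_comm N q i j)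
    simp only [map_sum, map_add, hFr, map_mul, Complex.coe_smul] at h
    rw [h, hK, hx, smul_smul]
  · intro i j
    rw [← hr, ract_d_x]
    simp only [map_sum, map_add, hFr, hl, map_mul, Complex.coe_smul, smul_mul_assoc]
    congr 1
    · congr 1
      rw [hη, ← smul_smul, ← hK, Finset.smul_sum]
      simp only [Finset.smul_sum, smul_smul]
    · rw [hη, Finset.mul_sum, Finset.smul_sum]
      simp only [Finset.mul_sum, Finset.smul_sum, smul_smul, mul_smul_comm, mul_assoc]
  -- Differentiating the radius relation gives `C^{kl} dx_k x_l + η = d(1) = 0`.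
  · have hD : ∀ b c, f (d N q (b + c)) = f (d N q b) + f (d N q c) := fun b c => by
      rw [d_add, map_add]
    have hDs : ∀ (c : ℂ) b, f (d N q (c • b)) = c • f (d N q b) := fun c b => by
      rw [d_smul, hl, Algebra.algebraMap_eq_smul_one, hF, map_one, smul_mul_assoc, one_mul]
    let D : Sphere N q →+ Ω := AddMonoidHom.mk' (fun b => f (d N q b)) hD
    have h : D (∑ k, ∑ l, (metric N q k l : ℂ) • (Sphere.x N q k * Sphere.x N q l)) = 0 := by
      rw [x_radius]
      change f (d N q 1) = 0
      rw [d_one, map_zero]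
    have hD' : ∀ b, D b = f (d N q b) := fun _ => rfl
    have hDr : ∀ (c : ℝ) b, f (d N q (c • b)) = c • f (d N q b) := fun c b => by
      rw [← Complex.coe_smul, hDs, Complex.coe_smul]
    simp only [map_sum] at h
    simp only [hD', hDr, d_mul, map_add, hr, hl, smul_add, Finset.sum_add_distrib,
      Complex.coe_smul] at h
    rw [← hη, sum_metric_smul fun k l => f (d N q (Sphere.x N q k)) * F (Sphere.x N q l)] at h
    exact eq_neg_of_add_eq_zero_left h
  · intro c hc
    have h := hker c hc
    simp only [gam, map_add, hl, hFr, smul_mul_assoc, Complex.coe_smul] at h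
    exact h
  · rw [← hdeta]
    simp only [Complex.coe_smul]
    rw [sum_metric_smul fun k l => f (d N q (Sphere.x N q k)) * f (d N q (Sphere.x N q l))]

/-- The radius relation gives `C^{kl} x_k γ_l = (1 + a) η`. As `1 + a ≠ 0`, the form `η`, and with
it `dx_i = γ_i - a x_i η`, lies in the left span of the `γ_i`. -/
theorem leftSpan_gam (hN : 3 ≤ N) (hq : 0 < q) (hq1 : q ≠ 1)
    (ha : a = alphaPlus N q ∨ a = alphaMinus N q) (θ : OneForms N q) :
    θ ∈ leftSpan (A := Sphere N q) (gam N q a) := by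
  have hlact : ∀ (b c : Sphere N q) (θ : OneForms N q), lact (b + c) θ = lact b θ + lact c θ := by
    intro b c θ
    rw [lact, Env.tmul_add_left, add_smul]; rfl
  have hsum : ∀ (s : Finset (Fin N)) (b : Fin N → Sphere N q) (θ : OneForms N q),
      lact (∑ k ∈ s, b k) θ = ∑ k ∈ s, lact (b k) θ := fun s b θ =>
    map_sum (AddMonoidHom.mk' (fun c => lact c θ) fun b c => hlact b c θ) b s
  have hη : lact (algebraMap ℂ (Sphere N q) ((1 + a : ℝ) : ℂ)) (eta N q) = ∑ k, ∑ l,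
      lact ((metric N q k l : ℂ) • Sphere.x N q k) (gam N q a l) := by
    simp only [gam, lact_add, Finset.sum_add_distrib, lact_lact]
    rw [show ∑ k, ∑ l, lact ((metric N q k l : ℂ) • Sphere.x N q k) (d N q (Sphere.x N q l)) =
      eta N q from rfl]
    have : ∑ k, ∑ l, lact ((metric N q k l : ℂ) • Sphere.x N q k * (a : ℂ) • Sphere.x N q l)
        (eta N q) = lact (algebraMap ℂ (Sphere N q) (a : ℂ)) (eta N q) := by
      simp only [← hsum]
      congr 1
      rw [Algebra.algebraMap_eq_smul_one, ← x_radius N q, Finset.smul_sum]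
      simp only [Finset.smul_sum, smul_mul_assoc, mul_smul_comm, smul_comm (a : ℂ)]
    rw [this]
    conv_rhs => rw [← one_lact (A := Sphere N q) (eta N q)]
    rw [lact_lact, mul_one, ← hlact]
    congr 1
    rw [Complex.ofReal_add, Complex.ofReal_one, map_add, map_one]
  have h1 : ((1 + a : ℝ) : ℂ) ≠ 0 := by exact_mod_cast one_add_ne_zero hN hq hq1 ha
  have hmem : eta N q ∈ leftSpan (A := Sphere N q) (gam N q a) := by
    have : eta N q = lact (algebraMap ℂ (Sphere N q) ((1 + a : ℝ) : ℂ)⁻¹)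
        (lact (algebraMap ℂ (Sphere N q) ((1 + a : ℝ) : ℂ)) (eta N q)) := by
      rw [lact_lact, ← map_mul, inv_mul_cancel₀ h1, map_one, one_lact]
    rw [this, hη]
    exact leftSpan_lact _ (sum_mem fun k _ => sum_mem fun l _ => lact_mem_leftSpan _ _)
  have hd : ∀ i, d N q (Sphere.x N q i) ∈ leftSpan (A := Sphere N q) (gam N q a) := by
    intro i
    rw [show d N q (Sphere.x N q i) = gam N q a i - lact ((a : ℂ) • Sphere.x N q i) (eta N q) by
      rw [gam, add_sub_cancel_right]]
    exact sub_mem (self_mem_leftSpan i) (leftSpan_lact _ hmem)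
  have hle : leftSpan (A := Sphere N q) (fun i => d N q (Sphere.x N q i)) ≤
      leftSpan (A := Sphere N q) (gam N q a) := by
    rw [leftSpan, AddSubgroup.closure_le]
    rintro _ ⟨b, i, rfl⟩
    exact leftSpan_lact _ (hd i)
  exact hle (leftSpan_d_x N q θ)

/-- The target is only assumed to be a semiring; negation comes from the scalar `-1`. The rewriting
uses real coefficients, so a complex subspace `T` is enough. -/
theorem word_mem_of_isChain {Ω : Type*} [Semiring Ω] [Algebra ℂ Ω]
    (F : Sphere N q →+* Ω) (f : OneForms N q →+ Ω) (hN : 3 ≤ N) (hq : 0 < q) (hq1 : q ≠ 1)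
    (ha : a = alphaPlus N q ∨ a = alphaMinus N q) (hF : ∀ (c : ℂ) b, F (c • b) = c • F b)
    (hl : ∀ b θ, f (lact b θ) = F b * f θ) (hr : ∀ θ b, f (ract θ b) = f θ * F b)
    (hker : ∀ c : Fin N → Fin N → ℝ,
      (∀ k l, ∑ i, ∑ j, c i j * (q * rMatInv N q k l i j) = c k l) →
      ∑ i, ∑ j, (c i j : ℂ) • (f (gam N q a i) * f (gam N q a j)) = 0)
    (hdeta : ∑ k, ∑ l, (metric N q k l : ℂ) •
      (f (d N q (Sphere.x N q k)) * f (d N q (Sphere.x N q l))) = 0)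
    (T : Submodule ℂ Ω) (w : List (Fin N))
    (hT : ∀ v : List (Fin N), v.length = w.length → v.IsChain (· < ·) →
      (v.map fun i => f (gam N q a i)).prod ∈ T) :
    (w.map fun i => f (gam N q a i)).prod ∈ T := by
  let _ : Ring Ω := Algebra.semiringToRing ℂ
  have hFr : ∀ (c : ℝ) b, F (c • b) = c • F b := fun c b => by
    rw [← Complex.coe_smul, hF, Complex.coe_smul]
  have h := sphereForms_of_map F f hF hl hr hker hdeta
  have hg : ∀ i, f (gam N q a i) =
      f (d N q (Sphere.x N q i)) + a • (F (Sphere.x N q i) * f (eta N q)) := by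
    intro i
    simp only [gam, map_add, hl, hFr, smul_mul_assoc, Complex.coe_smul]
  have hG := h.sum_gam_mul_gam hN hq hq1 ha hg
  have hR := h.rMatInv_gam hN hq hq1 hg
  simp only [hG, smul_zero, add_zero] at hR
  have hw := word_mem_span _ (mul_mem_span_of_le hq hR) w
  have hle : Submodule.span ℝ {p | ∃ v : List (Fin N), v.length = w.length ∧
      v.IsChain (· < ·) ∧ p = (v.map fun i => f (gam N q a i)).prod} ≤ T.restrictScalars ℝ := by
    rw [Submodule.span_le]
    rintro _ ⟨v, hv, hc, rfl⟩
    exact hT v hv hc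
  exact hle hw

end Realization

/-! ### Words in the `γ_i` inside `Γ^∧_{σ0}`. -/

section Forms
variable {N : ℕ} {q a : ℝ}

theorem smul_eq_fn_mul (b : Sphere N q) (ω : SigmaZeroForms N q a) : b • ω = fn N q a b * ω := rfl

theorem fn_smul (c : ℂ) (b : Sphere N q) : fn N q a (c • b) = c • fn N q a b := by
  change toSigmaZero N q a (toSigma N q a (fnT N q (c • b))) = _
  rw [fnT_smul, map_smul, map_smul]; rfl

theorem formT_ract (x : Sphere N q) (θ : OneForms N q) :
    formT N q (ract θ x) = formT N q θ * fnT N q x := by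
  have h := RingQuot.mkAlgHom_rel ℂ (TensorRel.right (A := Sphere N q) (M := OneForms N q) θ x)
  rw [map_mul] at h
  exact h

variable (N q a) in
/-- The map `Γ → Γ^∧_{σ0}` as an additive homomorphism. -/
def formHom : OneForms N q →+ SigmaZeroForms N q a :=
  (((toSigmaZero N q a).comp (toSigma N q a)).toRingHom : _ →+ _).comp (formT N q)

theorem formHom_apply (θ : OneForms N q) : formHom N q a θ = form N q a θ := rfl

theorem formHom_lact (b : Sphere N q) (θ : OneForms N q) :
    formHom N q a (lact b θ) = fn N q a b * formHom N q a θ := by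
  rw [formHom_apply, form, formT_lact, map_mul, map_mul]; rfl

theorem formHom_ract (θ : OneForms N q) (b : Sphere N q) :
    formHom N q a (ract θ b) = formHom N q a θ * fn N q a b := by
  rw [formHom_apply, form, formT_ract, map_mul, map_mul]; rfl

theorem algebraMap_smul_tensorForms (c : ℂ) (ω : TensorForms N q) :
    (algebraMap ℂ (Sphere N q) c) • ω = c • ω := by
  change fnT N q _ * ω = _
  rw [Algebra.algebraMap_eq_smul_one, fnT_smul, map_one, smul_mul_assoc, one_mul]

/-- Combine the generators of the graph of the braiding with the coefficients `c`; the eigenvector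
condition makes the two components equal. -/
theorem sum_smul_mem_antisymKernel (c : Fin N → Fin N → ℝ)
    (hc : ∀ k l, ∑ i, ∑ j, c i j * (q * rMatInv N q k l i j) = c k l) :
    ∑ i, ∑ j, (c i j : ℂ) • (formT N q (gam N q a i) * formT N q (gam N q a j)) ∈
      antisymKernel N q a := by
  have h : ∑ i, ∑ j, (algebraMap ℂ (Sphere N q) (c i j)) •
      ((formT N q (gam N q a i) * formT N q (gam N q a j),
        ∑ k, ∑ l, ((q * rMatInv N q k l i j : ℝ) : ℂ) •
        (formT N q (gam N q a k) * formT N q (gam N q a l))) :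
        TensorForms N q × TensorForms N q) ∈ braidingGraph N q a :=
    sum_mem fun i _ => sum_mem fun j _ =>
      Submodule.smul_mem _ _ (Submodule.subset_span ⟨(i, j), rfl⟩)
  refine Set.mem_ofPred.2 ?_
  convert h using 1
  ext1
  · simp only [Prod.fst_sum, Prod.smul_mk, algebraMap_smul_tensorForms]
  · simp only [Prod.snd_sum, Prod.smul_mk, algebraMap_smul_tensorForms, Finset.smul_sum, smul_smul]
    have e : ∀ k l, (c k l : ℂ) = ∑ i, ∑ j, (c i j : ℂ) * ((q * rMatInv N q k l i j : ℝ) : ℂ) := by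
      intro k l
      rw [← hc k l]
      simp only [Complex.ofReal_sum, Complex.ofReal_mul]
    conv_lhs => enter [2, k, 2, l]; rw [e k l]
    simp only [Finset.sum_smul]
    conv_lhs => enter [2, k]; rw [Finset.sum_comm]
    rw [Finset.sum_comm]
    refine Finset.sum_congr rfl fun i _ => ?_
    conv_lhs => enter [2, k]; rw [Finset.sum_comm]
    rw [Finset.sum_comm]

theorem formHom_antisym (c : Fin N → Fin N → ℝ)
    (hc : ∀ k l, ∑ i, ∑ j, c i j * (q * rMatInv N q k l i j) = c k l) :
    ∑ i, ∑ j, (c i j : ℂ) • (formHom N q a (gam N q a i) * formHom N q a (gam N q a j)) = 0 := by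
  have h : toSigma N q a
      (∑ i, ∑ j, (c i j : ℂ) • (formT N q (gam N q a i) * formT N q (gam N q a j))) =
      toSigma N q a 0 :=
    RingQuot.mkAlgHom_rel ℂ ⟨sum_smul_mem_antisymKernel c hc, rfl⟩
  have h' := congrArg (toSigmaZero N q a) h
  simp only [map_sum, map_smul, map_mul, map_zero] at h'
  exact h'

theorem formHom_deta : ∑ k, ∑ l, (metric N q k l : ℂ) •
    (formHom N q a (d N q (Sphere.x N q k)) * formHom N q a (d N q (Sphere.x N q l))) = 0 := by
  have h : toSigmaZero N q a (dEta N q a) = toSigmaZero N q a 0 :=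
    RingQuot.mkAlgHom_rel ℂ ⟨rfl, rfl⟩
  simp only [dEta, map_sum, map_smul, map_mul, map_zero] at h
  exact h

variable (N q a) in
/-- The left `X`-module generated by the words in the `γ_i` whose length satisfies `P`. -/
def wordSpan (P : ℕ → Prop) : Submodule (Sphere N q) (SigmaZeroForms N q a) :=
  Submodule.span _ {ω | ∃ w : List (Fin N), P w.length ∧
    ω = (w.map fun i => formHom N q a (gam N q a i)).prod}

/-- The predicates `P` and `Q` track word length, so that one statement serves both generation of
the whole algebra and the forms of a given order. -/
theorem formHom_mul_mem_wordSpan (hN : 3 ≤ N) (hq : 0 < q) (hq1 : q ≠ 1)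
    (ha : a = alphaPlus N q ∨ a = alphaMinus N q) {P Q : ℕ → Prop} (hPQ : ∀ n, P n → Q (n + 1))
    (θ : OneForms N q) {ω : SigmaZeroForms N q a} (hω : ω ∈ wordSpan N q a P) :
    formHom N q a θ * ω ∈ wordSpan N q a Q := by
  induction hω using Submodule.span_induction generalizing θ with
  | mem ω h =>
    obtain ⟨w, hw, rfl⟩ := h
    have hθ := leftSpan_gam hN hq hq1 ha θ
    induction hθ using AddSubgroup.closure_induction with
    | mem θ h =>
      obtain ⟨b, i, rfl⟩ := h
      rw [formHom_lact, mul_assoc, ← smul_eq_fn_mul]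
      exact Submodule.smul_mem _ _ (Submodule.subset_span
        ⟨i :: w, by rw [List.length_cons]; exact hPQ _ hw, by rw [List.map_cons, List.prod_cons]⟩)
    | zero => rw [map_zero, zero_mul]; exact zero_mem _
    | add m n _ _ h1 h2 => rw [map_add, add_mul]; exact add_mem h1 h2
    | neg m _ h =>
      rw [← neg_one_lact (A := Sphere N q), formHom_lact, mul_assoc, ← smul_eq_fn_mul]
      exact Submodule.smul_mem _ _ h
  | zero => rw [mul_zero]; exact zero_mem _
  | add m n _ _ h1 h2 => rw [mul_add]; exact add_mem (h1 θ) (h2 θ)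
  -- Left multiplication by `θ` is not `X`-linear: the function `b` is absorbed into `θ` from the
  -- right, which is why the induction keeps `θ` general.
  | smul b m _ h =>
    rw [smul_eq_fn_mul, ← mul_assoc, ← formHom_ract]
    exact h _

theorem wordSpan_eq_top (hN : 3 ≤ N) (hq : 0 < q) (hq1 : q ≠ 1)
    (ha : a = alphaPlus N q ∨ a = alphaMinus N q) : wordSpan N q a (fun _ => True) = ⊤ := by
  rw [eq_top_iff]
  rintro ω -
  obtain ⟨ω, rfl⟩ := RingQuot.mkAlgHom_surjective ℂ _ ω
  obtain ⟨ω, rfl⟩ := RingQuot.mkAlgHom_surjective ℂ _ ω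
  obtain ⟨z, rfl⟩ := RingQuot.mkAlgHom_surjective ℂ _ ω
  set π : FreeAlgebra ℂ (Sphere N q ⊕ OneForms N q) →ₐ[ℂ] SigmaZeroForms N q a :=
    ((toSigmaZero N q a).comp (toSigma N q a)).comp (RingQuot.mkAlgHom ℂ (TensorRel _ _)) with hπ
  -- Stability under left multiplication is proved, since it passes to products of symbols; applied
  -- to `1`, the empty word, it gives the claim.
  have key : ∀ m ∈ wordSpan N q a (fun _ => True), π z * m ∈ wordSpan N q a (fun _ => True) := by
    induction z using FreeAlgebra.induction with
    | grade0 c =>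
      intro m hm
      have : π (algebraMap ℂ _ c) * m = (algebraMap ℂ (Sphere N q) c) • m := by
        rw [AlgHom.commutes, smul_eq_fn_mul, Algebra.algebraMap_eq_smul_one (A := Sphere N q),
          fn_smul, map_one, Algebra.algebraMap_eq_smul_one]
      rw [this]
      exact Submodule.smul_mem _ _ hm
    | grade1 i =>
      intro m hm
      rcases i with b | θ
      · exact Submodule.smul_mem _ b hm
      · exact formHom_mul_mem_wordSpan hN hq hq1 ha (fun _ h => h) θ hm
    | mul b c hb hc => intro m hm; rw [map_mul, mul_assoc]; exact hb _ (hc _ hm)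
    | add b c hb hc => intro m hm; rw [map_add, add_mul]; exact add_mem (hb _ hm) (hc _ hm)
  have := key 1 (Submodule.subset_span ⟨[], trivial, by simp⟩)
  rw [mul_one] at this
  exact this

theorem wedge_eq_prod_map {s : ℕ} (i : Fin s → Fin N) :
    wedge N q a (fun r => gam N q a (i r)) =
      ((List.ofFn i).map fun i => formHom N q a (gam N q a i)).prod := by
  rw [wedge, List.map_ofFn]; rfl

theorem wedge_mem_wordSpan (hN : 3 ≤ N) (hq : 0 < q) (hq1 : q ≠ 1)
    (ha : a = alphaPlus N q ∨ a = alphaMinus N q) {n : ℕ} (θ : Fin n → OneForms N q) :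
    wedge N q a θ ∈ wordSpan N q a (· = n) := by
  induction n with
  | zero => exact Submodule.subset_span ⟨[], rfl, by simp [wedge]⟩
  | succ n ih =>
    have := formHom_mul_mem_wordSpan hN hq hq1 ha (P := (· = n)) (Q := (· = n + 1))
      (fun _ h => by rw [h]) (θ 0) (ih fun r => θ r.succ)
    rw [wedge, List.ofFn_succ, List.prod_cons]
    exact this

variable (a) in
/-- A left `X`-submodule of the forms as a complex subspace. -/
def toComplex (T : Submodule (Sphere N q) (SigmaZeroForms N q a)) :
    Submodule ℂ (SigmaZeroForms N q a) where
  carrier := T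
  add_mem' := T.add_mem
  zero_mem' := T.zero_mem
  smul_mem' c ω hω := by
    have : c • ω = (algebraMap ℂ (Sphere N q) c) • ω := by
      rw [smul_eq_fn_mul, Algebra.algebraMap_eq_smul_one, fn_smul, map_one, smul_mul_assoc, one_mul]
    rw [this]
    exact T.smul_mem _ hω

theorem wordSpan_le (hN : 3 ≤ N) (hq : 0 < q) (hq1 : q ≠ 1)
    (ha : a = alphaPlus N q ∨ a = alphaMinus N q) {P : ℕ → Prop}
    {T : Submodule (Sphere N q) (SigmaZeroForms N q a)}
    (hT : ∀ s, P s → s ≤ N → ∀ i : Fin s → Fin N, StrictMono i →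
      wedge N q a (fun r => gam N q a (i r)) ∈ T) : wordSpan N q a P ≤ T := by
  rw [wordSpan, Submodule.span_le]
  rintro _ ⟨w, hw, rfl⟩
  refine word_mem_of_isChain (fn N q a) (formHom N q a) hN hq hq1 ha fn_smul formHom_lact
    formHom_ract formHom_antisym formHom_deta (toComplex a T) w fun v hv hc => ?_
  -- A strictly increasing word has distinct letters, hence at most `N` of them.
  have hmono : StrictMono v.get := (List.isChain_iff_pairwise.1 hc).sortedLT.strictMono_get
  have hlen : v.length ≤ N := by
    simpa using Fintype.card_le_of_injective _ hmono.injective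
  have := hT v.length (hv ▸ hw) hlen v.get hmono
  rw [wedge_eq_prod_map, List.ofFn_get] at this
  exact this

end Forms

end QuantumSphere

end

theorem mainTheorem7 (N : ℕ) (hN : 3 ≤ N) (q : ℝ) (hq : 0 < q) (hq1 : q ≠ 1)
    (a : ℝ) (ha : a = QuantumSphere.alphaPlus N q ∨ a = QuantumSphere.alphaMinus N q) :
    Submodule.span (QuantumSphere.Sphere N q)
        {ω : QuantumSphere.SigmaZeroForms N q a | ∃ s : ℕ, s ≤ N ∧ ∃ i : Fin s → Fin N,
          StrictMono i ∧ ω = QuantumSphere.wedge N q a fun r => QuantumSphere.gam N q a (i r)} = ⊤ ∧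
      ∀ n : ℕ, N < n → QuantumSphere.formsOfOrder N q a n = ⊥ := by
  refine ⟨?_, fun n hn => ?_⟩
  · rw [eq_top_iff, ← QuantumSphere.wordSpan_eq_top hN hq hq1 ha]
    exact QuantumSphere.wordSpan_le hN hq hq1 ha fun s _ hs i hi =>
      Submodule.subset_span ⟨s, hs, i, hi, rfl⟩
  · rw [eq_bot_iff, QuantumSphere.formsOfOrder, Submodule.span_le]
    rintro _ ⟨θ, rfl⟩
    -- The reduction preserves length and increasing words have length at most `N < n`, so the zero
    -- submodule meets the requirement vacuously.
    refine QuantumSphere.wordSpan_le hN hq hq1 ha (P := (· = n)) (fun s hs hsN => ?_)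
      (QuantumSphere.wedge_mem_wordSpan hN hq hq1 ha θ)
    omega
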